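/- **Setting.** Let $\mathcal S=\mathcal S_1\times\dots\times\mathcal S_m$ be a finite state space and $\mathcal A$ a finite action space, let $\mathcal X=\mathcal S\times\mathcal A$ be identified with $\mathcal X_1\times\dots\times\mathcal X_n$, and for $Z\subseteq\{1,\dots,n\}$ write $\mathcal X[Z]=\prod_{i\in Z}\mathcal X_i$ and $x[Z]=(x_i)_{i\in Z}$. A *factored MDP* with scopes $Z^R_1,\dots,Z^R_l,Z^P_1,\dots,Z^P_m\subseteq\{1,\dots,n\}$ and horizon $\tau\ge 1$ consists of reward factors $R_i$, which assign to every $z\in\mathcal X[Z^R_i]$ a $\sigma$-sub-Gaussian probability measure on $\mathbb R$ with mean $\overline R_i(z)\in[0,C]$, such that the mean of the total reward $\overline R(x)=\sum_{i=1}^l\overline R_i(x[Z^R_i])$ lies in $[0,C]$ for all $x\in\mathcal X$; of transition factors $P_j(\cdot\mid z)$, probability mass functions on $\mathcal S_j$ for every $z\in\mathcal X[Z^P_j]$; and of an initial distribution $\rho$ on $\mathcal S$. Its transition function is $P(s'\mid x)=\prod_{j=1}^mP_j(s'_j\mid x[Z^P_j])$. It has the *symmetric structure* $\mathcal Q$ if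 $l+1=m$, $C=\sigma=1$, $|\mathcal S_i|=|\mathcal X_i|=K$ for all $i$, and $|Z^R_i|=|Z^P_j|=\zeta$ for all $i,j$; put $J=K^\zeta$. For a policy $\mu:\mathcal S\times\{1,\dots,\tau\}\to\mathcal A$ let $V^M_{\mu,i}(s)=\mathbb E_{M,\mu}\big[\sum_{j=i}^\tau\overline R(s_j,a_j)\,\big|\,s_i=s\big]$, where $a_j=\mu(s_j,j)$ and $s_{j+1}\sim P(\cdot\mid s_j,a_j)$, and let $\mu^*$ be an optimal policy of the true MDP $M^*$, i.e. one that maximizes $V^{M^*}_{\mu,i}(s)$ for all $s$ and $i$. The agent interacts with $M^*$ in episodes $k=1,2,\dots$ of length $\tau$, with initial states drawn from $\rho$; in episode $k$ it follows a policy $\mu_k$ that is a (measurable) function of the observations of the earlier episodes, and in every step, at the state-action pair $x$, it observes each reward factor $r^i\sim R_i(x[Z^R_i])$ and the next state $s'\sim P(\cdot\mid x)$. The regret up to time $T$ is $$\mathrm{Regret}(T)=\sum_{k=1}^{\lceil T/\tau\rceil}\sum_{s\in\mathcal S}\rho(s)\big(V^{M^*}_{\mu^*,1}(s)-V^{M^*}_{\mu_k,1}(s)\big).$$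 **UCRL-Factored**, with confidence parameter $\delta$, chooses $\mu_k$ as follows. For $z$ in the scope set of a factor let $n_k(z)$ be the number of steps in the first $k-1$ episodes whose state-action pair has scope variable $z$; for $n_k(z)>0$ let $\hat r_i(z)$ be the mean of the rewards $r^i$, and $\hat P_j(\cdot\mid z)$ the empirical distribution of the $j$-th component of the next state, observed in these steps. Let $\mathcal M_k$ be the set of all factored MDPs with the given structure (scopes, $\tau$, $C$, $\sigma$) and the given $\rho$ such that, for all $i,j$ and all $z$ with $n_k(z)>0$, $$|\overline R_i(z)-\hat r_i(z)|\le\sqrt{\frac{4\sigma^2\log\big(4l\,|\mathcal X[Z^R_i]|\,k/\delta\big)}{n_k(z)}},\qquad \|P_j(\cdot\mid z)-\hat P_j(\cdot\mid z)\|_1\le\sqrt{\frac{4|\mathcal S_j|\log\big(4m\,|\mathcal X[Z^P_j]|\,k/\delta\big)}{n_k(z)}}.$$ Then $\mu_k=\tilde\Gamma(\mathcal M_k,\sqrt{\tau/k})$, where $\tilde\Gamma$ is any planner which, for a non-empty family $\mathcal M$ and $\varepsilon>0$, returns an $\varepsilon$-optimal policy for a most optimistic realization from $\mathcal M$: there is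 $\tilde M\in\mathcal M$ such that the value $\sum_s\rho(s)V_{\mu,1}(s)$ of the policy $\mu=\tilde\Gamma(\mathcal M,\varepsilon)$ in $\tilde M$ is at least the value of every policy in every $M\in\mathcal M$, minus $\varepsilon$. **Statement.** For every factored MDP $M^*$ with the symmetric structure $\mathcal Q$, every $\delta\in(0,1)$ and every $T\in\mathbb N$, the regret of UCRL-Factored satisfies, with probability at least $1-\delta$, $$\mathrm{Regret}(T)\le 15\,m\,\tau\sqrt{J\,K\,T\,\log\!\big(12\,m\,J\,T/\delta\big)}$$ (the right-hand side being $0$ for $T=0$). -/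

import Mathlib

open MeasureTheory ProbabilityTheory
open scoped NNReal

universe uS uA uX uΩ

noncomputable section

/-- A graph structure of a factored MDP with state space `S = S₁ × ⋯ × Sₘ`, action space `A` and
`S × A = X₁ × ⋯ × Xₙ` (the identification is `split`), with the scopes of the `l` reward factors
and of the `m` transition factors, and with the horizon `τ`. -/
structure FactoredGraph {m n : ℕ} (S : Fin m → Type uS) (A : Type uA) (X : Fin n → Type uX)
    (l : ℕ) where
  split : (∀ j, S j) × A ≃ ∀ i, X i
  ZR : Fin l → Finset (Fin n)
  ZP : Fin m → Finset (Fin n)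
  τ : ℕ

/-- The scope set `X[Z] = ∏_{i ∈ Z} X_i`. The scope variable `x[Z]` is `Z.restrict x`. -/
abbrev ScopeSet {n : ℕ} (X : Fin n → Type uX) (Z : Finset (Fin n)) : Type uX :=
  ∀ i : Z, X i

/-- A `σ`-sub-Gaussian probability measure on `ℝ` with mean in `[0, C]`. -/
structure IsRewardLaw (C : ℝ) (σ : ℝ≥0) (ν : Measure ℝ) : Prop where
  prob : IsProbabilityMeasure ν
  mean_mem : (∫ r, r ∂ν) ∈ Set.Icc 0 C
  subgaussian : HasSubgaussianMGF (fun r => r - ∫ r', r' ∂ν) (σ ^ 2) ν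

section

variable {m n l : ℕ} {S : Fin m → Type uS} {A : Type uA} {X : Fin n → Type uX}
variable [∀ j, Fintype (S j)]

/-- A factored MDP with graph structure `G`. The factors of the reward function are
`σ`-sub-Gaussian with mean in `[0, C]`, and so is the mean of the total reward; the factors of
the transition function and the initial distribution `ρ` are probability mass functions. -/
structure FactoredMDP (G : FactoredGraph S A X l) (C : ℝ) (σ : ℝ≥0) where
  R : ∀ i : Fin l, ScopeSet X (G.ZR i) → Measure ℝ
  P : ∀ j : Fin m, ScopeSet X (G.ZP j) → S j → ℝ
  ρ : (∀ j, S j) → ℝ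
  R_law : ∀ i z, IsRewardLaw C σ (R i z)
  R_total : ∀ x : (∀ i, X i), (∑ i, ∫ r, r ∂(R i ((G.ZR i).restrict x))) ∈ Set.Icc 0 C
  P_mem : ∀ j z, P j z ∈ stdSimplex ℝ (S j)
  ρ_mem : ρ ∈ stdSimplex ℝ (∀ j, S j)

/-- Deterministic policies: an action for each step of the episode (`0, …, τ - 1`) and state. -/
abbrev FactoredGraph.Policy (G : FactoredGraph S A X l) : Type (max uS uA) :=
  Fin G.τ → (∀ j, S j) → A

namespace FactoredMDP

variable {G : FactoredGraph S A X l} {C : ℝ} {σ : ℝ≥0}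

/-- The mean reward `R̄(x)`, the sum of the means of the reward factors. -/
def meanReward (M : FactoredMDP G C σ) (x : ∀ i, X i) : ℝ :=
  ∑ i, ∫ r, r ∂(M.R i ((G.ZR i).restrict x))

/-- The transition probability `P(s' | x)`, the product of the transition factors. -/
def trans (M : FactoredMDP G C σ) (x : ∀ i, X i) (s' : ∀ j, S j) : ℝ :=
  ∏ j, M.P j ((G.ZP j).restrict x) (s' j)

open scoped Classical in
/-- `M.stateLaw μ i s d` is the law of the state at step `i + d` of an episode in which the state
at step `i` is `s` and the policy `μ` is followed (for `i + d ≤ τ`). -/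
def stateLaw (M : FactoredMDP G C σ) (μ : G.Policy) (i : Fin G.τ) (s : ∀ j, S j) :
    ℕ → (∀ j, S j) → ℝ
  | 0 => fun s' => if s' = s then 1 else 0
  | d + 1 => fun s' =>
      if h : (i : ℕ) + d < G.τ then
        ∑ v, stateLaw M μ i s d v * M.trans (G.split (v, μ ⟨(i : ℕ) + d, h⟩ v)) s'
      else 0

/-- The value function `V_{μ,i}(s)`: the sum over the steps `j = i, …` up to the end of the
episode of the expectation of `R̄(s_j, a_j)` given `s_i = s`. -/
def value (M : FactoredMDP G C σ) (μ : G.Policy) (i : Fin G.τ) (s : ∀ j, S j) : ℝ :=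
  ∑ j ∈ Finset.Ici i, ∑ v, M.stateLaw μ i s ((j : ℕ) - (i : ℕ)) v * M.meanReward (G.split (v, μ j v))

/-- `μ` is optimal for `M` : its value is maximal among all policies, at all steps and states. -/
def IsOptimal (M : FactoredMDP G C σ) (μ : G.Policy) : Prop :=
  ∀ (i : Fin G.τ) (s : ∀ j, S j) (μ' : G.Policy), M.value μ' i s ≤ M.value μ i s

/-- The value of an episode, `∑_s ρ(s) V_{μ,1}(s)`. -/
def episodeValue (M : FactoredMDP G C σ) (μ : G.Policy) : ℝ :=
  ∑ s, M.ρ s * (if h : 0 < G.τ then M.value μ ⟨0, h⟩ s else 0)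

/-- The regret up to time `T` of the policies `π 0, π 1, …`, where `μs` is an optimal policy. -/
def regret (M : FactoredMDP G C σ) (μs : G.Policy) (π : ℕ → G.Policy) (T : ℕ) : ℝ :=
  ∑ k ∈ Finset.range ⌈(T : ℝ) / (G.τ : ℝ)⌉₊, (M.episodeValue μs - M.episodeValue (π k))

end FactoredMDP

/-- A planner `Γ(𝓜, ε)` that returns an `ε`-optimal policy for a most optimistic realization from
the family `𝓜`. Optimism is measured by the value of an episode. -/
def IsOptimisticPlanner {G : FactoredGraph S A X l} {C : ℝ} {σ : ℝ≥0}
    (Γ : Set (FactoredMDP G C σ) → ℝ → G.Policy) : Prop :=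
  ∀ (𝓜 : Set (FactoredMDP G C σ)) (ε : ℝ), 𝓜.Nonempty → 0 < ε →
    ∃ M' ∈ 𝓜, ∀ M ∈ 𝓜, ∀ μ : G.Policy, M.episodeValue μ - ε ≤ M'.episodeValue (Γ 𝓜 ε)

/-- The observations, as functions on a sample space `Ω`. Episodes are numbered `0, 1, …` and the
steps of an episode `0, …, τ - 1`. In episode `k`, at step `u`, the state is
`state k u.castSucc`, then the action `action k u` is taken, the reward factors
`reward k u i` are observed, and the system moves to the state `state k u.succ`. After its last
step an episode ends (in the state `state k (Fin.last τ)`), and the state is reset. -/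
structure Observations (G : FactoredGraph S A X l) (Ω : Type uΩ) where
  state : ℕ → Fin (G.τ + 1) → Ω → ∀ j, S j
  action : ℕ → Fin G.τ → Ω → A
  reward : ℕ → Fin G.τ → Fin l → Ω → ℝ

namespace Observations

variable {G : FactoredGraph S A X l} {Ω : Type uΩ}

/-- The state-action pair at step `u` of episode `k`, as an element of `X₁ × ⋯ × Xₙ`. -/
def pair (O : Observations G Ω) (k : ℕ) (u : Fin G.τ) (ω : Ω) : ∀ i, X i :=
  G.split (O.state k u.castSucc ω, O.action k u ω)

/-- The history of all the observations made before episode `k`. -/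
@[reducible] def episodeHistory (O : Observations G Ω) (k : ℕ) : MeasurableSpace Ω :=
  ⨆ k' : Fin k,
    (⨆ u : Fin (G.τ + 1), MeasurableSpace.comap (O.state k' u) ⊤) ⊔
    (⨆ u : Fin G.τ, MeasurableSpace.comap (O.action k' u) ⊤) ⊔
    (⨆ u : Fin G.τ, ⨆ i : Fin l, MeasurableSpace.comap (O.reward k' u i) (borel ℝ))

/-- The history up to the action at step `u` of episode `k` (included), but without the reward
and the transition that follow it. -/
@[reducible] def stepHistory (O : Observations G Ω) (k : ℕ) (u : Fin G.τ) : MeasurableSpace Ω :=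
  O.episodeHistory k ⊔
    (⨆ v : Set.Iic u, MeasurableSpace.comap (O.state k v.1.castSucc) ⊤) ⊔
    (⨆ v : Set.Iic u, MeasurableSpace.comap (O.action k v) ⊤) ⊔
    (⨆ v : Set.Iio u, ⨆ i : Fin l, MeasurableSpace.comap (O.reward k v i) (borel ℝ))

open scoped Classical in
/-- The (episode, step) pairs before episode `k` at which the scope variable `x[Z]` was `z`. -/
def visits (O : Observations G Ω) (k : ℕ) (ω : Ω) (Z : Finset (Fin n)) (z : ScopeSet X Z) :
    Finset (ℕ × Fin G.τ) :=
  (Finset.range k ×ˢ Finset.univ).filter (fun p => Z.restrict (O.pair p.1 p.2 ω) = z)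

/-- The mean of the empirical distribution of the `i`-th reward factor at `z`, at the start of
episode `k`. -/
def empReward (O : Observations G Ω) (k : ℕ) (ω : Ω) (i : Fin l) (z : ScopeSet X (G.ZR i)) : ℝ :=
  (∑ p ∈ O.visits k ω (G.ZR i) z, O.reward p.1 p.2 i ω) / ((O.visits k ω (G.ZR i) z).card : ℝ)

open scoped Classical in
/-- The empirical distribution of the `j`-th transition factor at `z`, at the start of
episode `k`. -/
def empTrans (O : Observations G Ω) (k : ℕ) (ω : Ω) (j : Fin m) (z : ScopeSet X (G.ZP j))
    (y : S j) : ℝ :=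
  (((O.visits k ω (G.ZP j) z).filter (fun p => O.state p.1 p.2.succ ω j = y)).card : ℝ) /
    ((O.visits k ω (G.ZP j) z).card : ℝ)

end Observations

/-- The observations `O` come from repeated episodes in the MDP `M`, where the policy `π k`, which
is a function of the history before episode `k`, is employed during episode `k`. Given the
history, the initial state of an episode has law `ρ`, the `i`-th reward factor has law
`R_i(x[Z_i])` and the next state has law `P(· | x)`. -/
structure IsInteraction {G : FactoredGraph S A X l} {C : ℝ} {σ : ℝ≥0} {Ω : Type uΩ}
    [mΩ : MeasurableSpace Ω] (Pr : Measure Ω) (M : FactoredMDP G C σ) (π : ℕ → Ω → G.Policy)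
    (O : Observations G Ω) : Prop where
  state_meas : ∀ k u, Measurable[mΩ, ⊤] (O.state k u)
  action_meas : ∀ k u, Measurable[mΩ, ⊤] (O.action k u)
  reward_meas : ∀ k u i, Measurable (O.reward k u i)
  policy_meas : ∀ k, Measurable[O.episodeHistory k, ⊤] (π k)
  action_eq : ∀ k u ω, O.action k u ω = π k ω u (O.state k u.castSucc ω)
  init_law : ∀ (k : ℕ) (s : ∀ j, S j),
    Pr[Set.indicator {ω | O.state k 0 ω = s} (fun _ => (1 : ℝ)) | O.episodeHistory k]
      =ᵐ[Pr] fun _ => M.ρ s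
  reward_law : ∀ (k : ℕ) (u : Fin G.τ) (i : Fin l) (B : Set ℝ), MeasurableSet B →
    Pr[Set.indicator {ω | O.reward k u i ω ∈ B} (fun _ => (1 : ℝ)) | O.stepHistory k u]
      =ᵐ[Pr] fun ω => (M.R i ((G.ZR i).restrict (O.pair k u ω))).real B
  next_law : ∀ (k : ℕ) (u : Fin G.τ) (s' : ∀ j, S j),
    Pr[Set.indicator {ω | O.state k u.succ ω = s'} (fun _ => (1 : ℝ)) | O.stepHistory k u]
      =ᵐ[Pr] fun ω => M.trans (O.pair k u ω) s'

variable [∀ i, Fintype (X i)]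

/-- The squared confidence radius of a reward factor in episode `k` (episodes counted from `0`). -/
def dReward (G : FactoredGraph S A X l) (σ : ℝ≥0) (δ : ℝ) (k : ℕ) (i : Fin l) : ℝ :=
  4 * (σ : ℝ) ^ 2 *
    Real.log (4 * l * (Fintype.card (ScopeSet X (G.ZR i)) : ℝ) * ((k : ℝ) + 1) / δ)

/-- The squared confidence radius of a transition factor in episode `k` (counted from `0`). -/
def dTrans (G : FactoredGraph S A X l) (δ : ℝ) (k : ℕ) (j : Fin m) : ℝ :=
  4 * (Fintype.card (S j) : ℝ) *
    Real.log (4 * m * (Fintype.card (ScopeSet X (G.ZP j)) : ℝ) * ((k : ℝ) + 1) / δ)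

/-- The confidence set `𝓜_k` of UCRL-Factored in episode `k` (counted from `0`): the factored MDPs
with the given graph structure and initial distribution for which, at all scope variables visited
before, the means of the reward factors and (in `ℓ¹`) the transition factors are close to the
empirical ones. -/
def confidenceSet {G : FactoredGraph S A X l} {Ω : Type uΩ} (C : ℝ) (σ : ℝ≥0) (δ : ℝ)
    (ρ : (∀ j, S j) → ℝ) (O : Observations G Ω) (k : ℕ) (ω : Ω) : Set (FactoredMDP G C σ) :=
  {M | M.ρ = ρ ∧
    (∀ (i : Fin l) (z : ScopeSet X (G.ZR i)), 0 < (O.visits k ω (G.ZR i) z).card →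
      |(∫ r, r ∂(M.R i z)) - O.empReward k ω i z| ≤
        √(dReward G σ δ k i / ((O.visits k ω (G.ZR i) z).card : ℝ))) ∧
    (∀ (j : Fin m) (z : ScopeSet X (G.ZP j)), 0 < (O.visits k ω (G.ZP j) z).card →
      (∑ y, |M.P j z y - O.empTrans k ω j z y|) ≤
        √(dTrans G δ k j / ((O.visits k ω (G.ZP j) z).card : ℝ)))}

/-- The policies chosen by UCRL-Factored with confidence parameter `δ` and planner `Γ`: in the
`k`-th episode (counted from `1`) the policy `Γ(𝓜_k, √(τ/k))`. -/
def ucrlFactored {G : FactoredGraph S A X l} {Ω : Type uΩ} {C : ℝ} {σ : ℝ≥0}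
    (Γ : Set (FactoredMDP G C σ) → ℝ → G.Policy) (δ : ℝ) (ρ : (∀ j, S j) → ℝ)
    (O : Observations G Ω) (k : ℕ) (ω : Ω) : G.Policy :=
  Γ (confidenceSet C σ δ ρ O k ω) (√((G.τ : ℝ) / ((k : ℝ) + 1)))

/-- The symmetric structure `𝒬`: `l + 1 = m`, all the factors of the state space and of `S × A` have
`K` elements, and all the scopes have `ζ` elements. -/
structure IsSymmetricGraph (G : FactoredGraph S A X l) (K ζ : ℕ) : Prop where
  num : l + 1 = m
  card_S : ∀ j, Fintype.card (S j) = K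
  card_X : ∀ i, Fintype.card (X i) = K
  card_ZR : ∀ i, (G.ZR i).card = ζ
  card_ZP : ∀ j, (G.ZP j).card = ζ

end

end

/-! Suppose that the true MDP `M` lies in the confidence set of an episode. By optimism, the chosen
policy is worth, in some `M'` of that set, at least the optimal value in `M` minus the planning
error. The regret of the episode is thus at most this error plus the difference of the values of one
policy in two plausible MDPs (`episodeValue_sub_ucrlFactored_le`). Unrolling the Bellman recursion
turns this difference into an expectation, under `M`, of one-step errors. Since the `ℓ¹` distance of
product distributions is at most the sum over the factors (`sum_abs_prod_sub_prod_le`), a one-step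
error is bounded by confidence widths of single factors, those of the transitions being multiplied
by `τ - 1`.

The planner's `M'` need not depend measurably on the data, so its value function is unsuitable as a
martingale score. It is replaced by `clippedGap`, which is determined by the policy and the visit
counts and is clipped so that it stays bounded by the number of steps to go. An Azuma–Hoeffding
inequality (`IsInteraction.measure_sum_arrivalDiff_ge_le`) then replaces the expected gaps by the
widths along the observed path (`IsInteraction.sum_mul_clippedGap_le`), and a pigeonhole argument
sums these widths (`Observations.sum_factorWidth_le`).

That `M` lies in the confidence sets is shown by a union bound over the number `n` of visits instead
of the episodes. An exponential product frozen after `n` visits controls all the episode starts with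
count `n` at once (`Observations.measure_sum_visits_ge_le`). As `n ≤ k τ`, the logarithm of `k` in
the radius can be replaced by one of a quantity depending on `n` (`visitScale`). From episode `2 τ`
on the resulting failure probabilities have a sum that is small uniformly in `τ`; the earlier
episodes cost at most `2 τ²`.

Rewards, transitions and the martingale each fail with probability at most `δ / 4`. If the claimed
bound is at least the trivial bound `N τ` on the regret of `N` episodes, nothing is left to prove;
otherwise `T` is so large that the lower-order terms fit into the constant 15 (`regret_bound_le`).
-/

/-! ### Conditional exponential moments -/

section Probability

open scoped ENNReal

/-- A nonnegative random variable whose conditional mean given `F` is at most one. -/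
def CondMeanLEOne {Ω : Type*} (F : MeasurableSpace Ω) {_m : MeasurableSpace Ω} (P : Measure Ω)
    (Y : Ω → ℝ≥0∞) : Prop :=
  ∀ f : Ω → ℝ≥0∞, Measurable[F] f → ∫⁻ ω, f ω * Y ω ∂P ≤ ∫⁻ ω, f ω ∂P

/-- The hypothesis says that, on `F`, the measure with density `Y` is dominated by `P`; domination
of measures passes to integrals of `F`-measurable functions. -/
theorem condMeanLEOne_of_setLIntegral_le {Ω : Type*} {F m : MeasurableSpace Ω} (hF : F ≤ m)
    {P : Measure Ω} {Y : Ω → ℝ≥0∞} (hY : Measurable Y)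
    (h : ∀ E, MeasurableSet[F] E → ∫⁻ ω in E, Y ω ∂P ≤ P E) : CondMeanLEOne F P Y := by
  intro f hf
  have hle : (P.withDensity Y).trim hF ≤ P.trim hF := by
    refine Measure.le_iff.2 fun s hs => ?_
    rw [trim_measurableSet_eq hF hs, trim_measurableSet_eq hF hs, withDensity_apply _ (hF s hs)]
    exact h s hs
  calc ∫⁻ ω, f ω * Y ω ∂P = ∫⁻ ω, f ω ∂(P.withDensity Y) := by
        rw [lintegral_withDensity_eq_lintegral_mul _ hY (hf.mono hF le_rfl)]
        simp only [Pi.mul_apply, mul_comm]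
    _ = ∫⁻ ω, f ω ∂(P.withDensity Y).trim hF := (lintegral_trim hF hf).symm
    _ ≤ ∫⁻ ω, f ω ∂P.trim hF := lintegral_mono' hle le_rfl
    _ = ∫⁻ ω, f ω ∂P := lintegral_trim hF hf

theorem condMeanLEOne_one {Ω : Type*} (F : MeasurableSpace Ω) {_m : MeasurableSpace Ω}
    (P : Measure Ω) : CondMeanLEOne F P (fun _ => 1) := by
  intro f _
  simp

/-- The last factor is removed first: `f` and all the earlier factors are measurable for its
σ-algebra and serve together as the test function. -/
theorem lintegral_mul_prod_le {Ω : Type*} {m : MeasurableSpace Ω} {P : Measure Ω} :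
    ∀ {n : ℕ} {F : Fin n → MeasurableSpace Ω} {Y : Fin n → Ω → ℝ≥0∞},
      (∀ i, CondMeanLEOne (F i) P (Y i)) → (∀ i j, i < j → Measurable[F j] (Y i)) →
      ∀ {f : Ω → ℝ≥0∞}, (∀ i, Measurable[F i] f) →
        ∫⁻ ω, f ω * ∏ i, Y i ω ∂P ≤ ∫⁻ ω, f ω ∂P
  | 0, F, Y, _, _, f, _ => by simp
  | n + 1, F, Y, h, hY, f, hf => by
    have ih := lintegral_mul_prod_le (P := P) (F := fun i : Fin n => F i.castSucc)
      (Y := fun i : Fin n => Y i.castSucc) (fun i => h _)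
      (fun i j hij => hY _ _ (Fin.castSucc_lt_castSucc_iff.2 hij)) (fun i => hf _)
    refine le_trans ?_ ih
    simp only [Fin.prod_univ_castSucc, ← mul_assoc]
    refine h (Fin.last n) (fun ω => f ω * ∏ i : Fin n, Y i.castSucc ω) ?_
    exact Measurable.mul (hf _)
      (Finset.measurable_fun_prod _ fun i _ => hY _ _ (Fin.castSucc_lt_last i))

/-- A function that factors through a measurable map to a finite set is measurable. -/
theorem measurable_of_factorsThrough {Ω β γ : Type*} {F : MeasurableSpace Ω} [Finite β]
    [MeasurableSpace γ] (Φ : Ω → β) (hΦ : ∀ b, MeasurableSet[F] (Φ ⁻¹' {b})) {f : Ω → γ}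
    (h : ∀ ω ω', Φ ω = Φ ω' → f ω = f ω') : Measurable[F] f := by
  intro B _
  have : f ⁻¹' B = ⋃ b ∈ Φ '' (f ⁻¹' B), Φ ⁻¹' {b} := by
    ext ω
    simp only [Set.mem_preimage, Set.mem_iUnion, Set.mem_singleton_iff, Set.mem_image]
    constructor
    · intro hω
      exact ⟨Φ ω, ⟨ω, hω, rfl⟩, rfl⟩
    · rintro ⟨b, ⟨ω', hω', rfl⟩, hb⟩
      rwa [h ω ω' hb]
  rw [this]
  exact MeasurableSet.biUnion (Set.to_countable _) fun b _ => hΦ b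

/-- By the defining property of the conditional expectation, `P` restricted to `A` and the measure
with density `g` agree on `F`. Passing to `∫⁻` makes the integrability of `f` irrelevant. -/
theorem setLIntegral_eq_of_condExp_indicator {Ω : Type*} {F m : MeasurableSpace Ω} (hF : F ≤ m)
    {P : Measure Ω} [IsProbabilityMeasure P] {A : Set Ω} (hA : MeasurableSet A) {g : Ω → ℝ}
    (hg : Measurable[F] g) (hg0 : ∀ ω, 0 ≤ g ω)
    (h : P[A.indicator (fun _ => (1 : ℝ)) | F] =ᵐ[P] g) {f : Ω → ℝ≥0∞} (hf : Measurable[F] f) :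
    ∫⁻ ω in A, f ω ∂P = ∫⁻ ω, ENNReal.ofReal (g ω) * f ω ∂P := by
  have hint : Integrable (A.indicator (fun _ => (1 : ℝ))) P :=
    (integrable_const _).indicator hA
  have hgi : Integrable g P := (integrable_congr h).1 integrable_condExp
  have hgm : Measurable (fun ω => ENNReal.ofReal (g ω)) :=
    ENNReal.measurable_ofReal.comp (hg.mono hF le_rfl)
  have heq : (P.restrict A).trim hF = (P.withDensity (fun ω => ENNReal.ofReal (g ω))).trim hF := by
    refine @Measure.ext _ F _ _ fun s hs => ?_
    rw [trim_measurableSet_eq hF hs, trim_measurableSet_eq hF hs,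
      withDensity_apply _ (hF s hs), Measure.restrict_apply (hF s hs),
      ← ofReal_integral_eq_lintegral_ofReal hgi.integrableOn
        (Filter.Eventually.of_forall fun ω => hg0 ω)]
    have h1 : ∫ ω in s, g ω ∂P = ∫ ω in s, A.indicator (fun _ => (1 : ℝ)) ω ∂P := by
      rw [← setIntegral_condExp hF hint hs]
      exact integral_congr_ae (ae_restrict_of_ae (h.mono fun ω hω => hω.symm))
    rw [h1, setIntegral_indicator hA]
    simp [Measure.real, ENNReal.ofReal_toReal]
  rw [← lintegral_trim hF hf, heq, lintegral_trim hF hf,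
    lintegral_withDensity_eq_lintegral_mul _ hgm (hf.mono hF le_rfl)]
  rfl

/-- Hoeffding's lemma for a probability vector. -/
theorem sum_mul_exp_le_of_mem_Icc {V : Type*} [Fintype V] {p φ : V → ℝ}
    (hp : p ∈ stdSimplex ℝ V) {a b : ℝ} (hφ : ∀ v, φ v ∈ Set.Icc a b) (t : ℝ) :
    ∑ v, p v * Real.exp (t * (φ v - ∑ w, p w * φ w)) ≤ Real.exp (t ^ 2 * (b - a) ^ 2 / 8) := by
  classical
  let _ : MeasurableSpace V := ⊤
  let ν : Measure V := ∑ v, ENNReal.ofReal (p v) • Measure.dirac v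
  have hint : ∀ f : V → ℝ, ∫ v, f v ∂ν = ∑ v, p v * f v := by
    intro f
    rw [integral_finsetSum_measure (fun i _ => ?_)]
    · refine Finset.sum_congr rfl fun v _ => ?_
      rw [integral_smul_measure, integral_dirac, ENNReal.toReal_ofReal (hp.1 v), smul_eq_mul]
    · exact (integrable_dirac (by finiteness)).smul_measure ENNReal.ofReal_ne_top
  have hν : IsProbabilityMeasure ν := by
    constructor
    simp only [ν, Measure.coe_finsetSum, Finset.sum_apply, Measure.smul_apply, measure_univ,
      smul_eq_mul, mul_one]
    rw [← ENNReal.ofReal_sum_of_nonneg fun v _ => hp.1 v, hp.2, ENNReal.ofReal_one]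
  have h := hasSubgaussianMGF_of_mem_Icc (μ := ν) (X := φ) (a := a) (b := b)
    (measurable_of_finite φ).aemeasurable (Filter.Eventually.of_forall hφ)
  have h2 := h.mgf_le t
  simp only [mgf, hint] at h2
  refine h2.trans (le_of_eq ?_)
  congr 1
  simp only [NNReal.coe_pow, NNReal.coe_div, coe_nnnorm, NNReal.coe_ofNat, div_pow,
    Real.norm_eq_abs, sq_abs]
  ring

/-- A conditional version of Hoeffding's lemma for a random variable with values in a finite
set. -/
theorem condMeanLEOne_exp_of_finite {Ω V : Type*} [Fintype V] {F m : MeasurableSpace Ω}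
    (hF : F ≤ m) {P : Measure Ω} [IsProbabilityMeasure P] {Y : Ω → V}
    (hY : ∀ v, MeasurableSet {ω | Y ω = v}) {p φ : Ω → V → ℝ}
    (hpm : ∀ v, Measurable[F] fun ω => p ω v) (hp : ∀ ω, p ω ∈ stdSimplex ℝ V)
    (hφm : ∀ v, Measurable[F] fun ω => φ ω v) {a b : ℝ} (hφ : ∀ ω v, φ ω v ∈ Set.Icc a b)
    (hlaw : ∀ v, P[Set.indicator {ω | Y ω = v} (fun _ => (1 : ℝ)) | F] =ᵐ[P] fun ω => p ω v)
    (t : ℝ) :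
    CondMeanLEOne F P fun ω => ENNReal.ofReal
      (Real.exp (t * (φ ω (Y ω) - ∑ v, p ω v * φ ω v) - t ^ 2 * (b - a) ^ 2 / 8)) := by
  intro f hf
  set g : V → Ω → ℝ := fun v ω =>
    Real.exp (t * (φ ω v - ∑ w, p ω w * φ ω w) - t ^ 2 * (b - a) ^ 2 / 8) with hgdef
  have hg : ∀ v, Measurable[F] (g v) := by
    intro v
    refine Real.measurable_exp.comp (Measurable.sub_const (Measurable.const_mul ?_ t) _)
    exact (hφm v).sub (Finset.measurable_fun_sum _ fun w _ => (hpm w).mul (hφm w))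
  have hfg : ∀ v, Measurable[F] fun ω => f ω * ENNReal.ofReal (g v ω) := fun v =>
    hf.mul (ENNReal.measurable_ofReal.comp (hg v))
  calc ∫⁻ ω, f ω * ENNReal.ofReal (g (Y ω) ω) ∂P
      = ∫⁻ ω, ∑ v, ({ω | Y ω = v} : Set Ω).indicator
          (fun ω => f ω * ENNReal.ofReal (g v ω)) ω ∂P := by
        refine lintegral_congr fun ω => ?_
        classical
        rw [Finset.sum_eq_single (Y ω)]
        · rw [Set.indicator_of_mem]
          rfl
        · intro v _ hv
          rw [Set.indicator_of_notMem]
          exact fun h => hv h.symm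
        · simp
    _ = ∑ v, ∫⁻ ω in {ω | Y ω = v}, f ω * ENNReal.ofReal (g v ω) ∂P := by
        rw [lintegral_finsetSum _ fun v _ => ((hfg v).mono hF le_rfl).indicator (hY v)]
        exact Finset.sum_congr rfl fun v _ => lintegral_indicator (hY v) _
    _ = ∑ v, ∫⁻ ω, ENNReal.ofReal (p ω v) * (f ω * ENNReal.ofReal (g v ω)) ∂P :=
        Finset.sum_congr rfl fun v _ => setLIntegral_eq_of_condExp_indicator hF (hY v) (hpm v)
          (fun ω => (hp ω).1 v) (hlaw v) (hfg v)
    _ = ∫⁻ ω, ∑ v, ENNReal.ofReal (p ω v) * (f ω * ENNReal.ofReal (g v ω)) ∂P := by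
        rw [lintegral_finsetSum]
        exact fun v _ => ((ENNReal.measurable_ofReal.comp (hpm v)).mul (hfg v)).mono hF le_rfl
    _ ≤ ∫⁻ ω, f ω ∂P := by
        refine lintegral_mono fun ω => ?_
        have h1 : ∑ v, p ω v * g v ω ≤ 1 := by
          have h2 := sum_mul_exp_le_of_mem_Icc (hp ω) (hφ ω) t
          have h3 : ∑ v, p ω v * g v ω = (∑ v, p ω v *
              Real.exp (t * (φ ω v - ∑ w, p ω w * φ ω w))) *
                Real.exp (-(t ^ 2 * (b - a) ^ 2 / 8)) := by
            rw [Finset.sum_mul]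
            refine Finset.sum_congr rfl fun v _ => ?_
            rw [mul_assoc, ← Real.exp_add, ← sub_eq_add_neg]
          rw [h3, Real.exp_neg, ← div_eq_mul_inv]
          exact div_le_one_of_le₀ h2 (Real.exp_pos _).le
        calc ∑ v, ENNReal.ofReal (p ω v) * (f ω * ENNReal.ofReal (g v ω))
            = f ω * ENNReal.ofReal (∑ v, p ω v * g v ω) := by
              rw [ENNReal.ofReal_sum_of_nonneg fun v _ =>
                mul_nonneg ((hp ω).1 v) (Real.exp_pos _).le, Finset.mul_sum]
              refine Finset.sum_congr rfl fun v _ => ?_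
              rw [ENNReal.ofReal_mul ((hp ω).1 v)]
              ring
          _ ≤ f ω * 1 := by
              gcongr
              exact ENNReal.ofReal_le_one.2 h1
          _ = f ω := mul_one _

/-- A conditionally sub-Gaussian random variable with a conditional law that is known on `B`. -/
theorem condMeanLEOne_exp_of_law {Ω : Type*} {F m : MeasurableSpace Ω}
    (hF : F ≤ m) {P : Measure Ω} [IsProbabilityMeasure P] {Y : Ω → ℝ} (hY : Measurable Y)
    {B : Set Ω} (hB : MeasurableSet[F] B) {κ : Ω → Measure ℝ} {ν : Measure ℝ}
    [IsProbabilityMeasure ν] (hκ : ∀ ω ∈ B, κ ω = ν) {ψ : ℝ → ℝ≥0∞} (hψ : Measurable ψ)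
    (hν : ∫⁻ r, ψ r ∂ν ≤ 1)
    (hlaw : ∀ D, MeasurableSet D →
      P[Set.indicator {ω | Y ω ∈ D} (fun _ => (1 : ℝ)) | F] =ᵐ[P] fun ω => (κ ω).real D) :
    CondMeanLEOne F P (B.indicator (fun ω => ψ (Y ω)) + Bᶜ.indicator 1) := by
  refine condMeanLEOne_of_setLIntegral_le hF (((hψ.comp hY).indicator (hF _ hB)).add
    (measurable_one.indicator (hF _ hB).compl)) fun E hE => ?_
  have hEB : MeasurableSet (E ∩ B) := (hF _ hE).inter (hF _ hB)
  -- The conditional law is the constant `ν` on `E ∩ B`, so the law of `Y` there is a multiple of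
  -- `ν`. Hence no measurability of `κ` is needed.
  have hmap : (P.restrict (E ∩ B)).map Y = P (E ∩ B) • ν := by
    ext D hD
    rw [Measure.map_apply hY hD, Measure.restrict_apply (hY hD), Measure.smul_apply, smul_eq_mul]
    have hint : Integrable (Set.indicator {ω | Y ω ∈ D} (fun _ => (1 : ℝ))) P :=
      (integrable_const _).indicator (hY hD)
    have h1 : ∫ ω in E ∩ B, Set.indicator {ω | Y ω ∈ D} (fun _ => (1 : ℝ)) ω ∂P
        = ∫ ω in E ∩ B, ν.real D ∂P := by
      rw [← setIntegral_condExp hF hint (hE.inter hB)]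
      refine setIntegral_congr_ae hEB ?_
      filter_upwards [hlaw D hD] with ω hω hωB
      rw [hω, hκ ω hωB.2]
    have hYD : MeasurableSet {ω | Y ω ∈ D} := hY hD
    rw [setIntegral_indicator hYD] at h1
    simp only [integral_const, MeasurableSet.univ, measureReal_restrict_apply, Set.univ_inter,
      smul_eq_mul, mul_one] at h1
    have h2 : P.real (Y ⁻¹' D ∩ (E ∩ B)) = P.real (E ∩ B) * ν.real D := by
      rw [Set.inter_comm]
      exact h1
    simp only [Measure.real, ← ENNReal.toReal_mul] at h2
    exact (ENNReal.toReal_eq_toReal_iff' (measure_ne_top _ _) (by finiteness)).1 h2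
  have h3 : ∫⁻ ω in E, B.indicator (fun ω => ψ (Y ω)) ω ∂P ≤ P (E ∩ B) := by
    rw [setLIntegral_indicator (hF _ hB), Set.inter_comm, ← lintegral_map hψ hY, hmap,
      lintegral_smul_measure, smul_eq_mul]
    exact mul_le_of_le_one_right' hν
  have h4 : ∫⁻ ω in E, Bᶜ.indicator 1 ω ∂P = P (E ∩ Bᶜ) := by
    rw [setLIntegral_indicator (hF _ hB).compl, Set.inter_comm]
    simp
  simp only [Pi.add_apply]
  rw [lintegral_add_right _ (measurable_one.indicator (hF _ hB).compl), h4]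
  calc _ ≤ P (E ∩ B) + P (E ∩ Bᶜ) := by gcongr
    _ = P E := by
      rw [← Set.sdiff_eq]
      exact measure_inter_add_sdiff _ (hF _ hB)

end Probability

/-! ### Product distributions in `ℓ¹` -/

section ProductMass

theorem sum_pi_prod {m : ℕ} {S : Fin m → Type uS} [∀ j, Fintype (S j)] (f : ∀ j, S j → ℝ) :
    ∑ s : ∀ j, S j, ∏ j, f j (s j) = ∏ j, ∑ y, f j y := by
  rw [Finset.prod_univ_sum, Fintype.piFinset_univ]

/-- The `ℓ¹` distance of product distributions is at most the sum of the `ℓ¹` distances of the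
factors. -/
theorem sum_abs_prod_sub_prod_le : ∀ {m : ℕ} {S : Fin m → Type uS} [∀ j, Fintype (S j)]
    {a b : ∀ j, S j → ℝ}, (∀ j, a j ∈ stdSimplex ℝ (S j)) → (∀ j, b j ∈ stdSimplex ℝ (S j)) →
    ∑ s : ∀ j, S j, |∏ j, a j (s j) - ∏ j, b j (s j)| ≤ ∑ j, ∑ y, |a j y - b j y|
  | 0, S, _, a, b, _, _ => by simp
  | m + 1, S, _, a, b, ha, hb => by
    have ih := sum_abs_prod_sub_prod_le (fun j : Fin m => ha j.succ) (fun j : Fin m => hb j.succ)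
    rw [← (Fin.consEquiv S).sum_comp, Fintype.sum_prod_type, Fin.sum_univ_succ]
    simp only [Fin.consEquiv, Equiv.coe_fn_mk, Fin.prod_univ_succ, Fin.cons_zero, Fin.cons_succ]
    have hA : ∑ s : ∀ j : Fin m, S j.succ, ∏ j : Fin m, a j.succ (s j) = 1 := by
      rw [sum_pi_prod (fun j : Fin m => a j.succ)]
      exact Finset.prod_eq_one fun j _ => (ha j.succ).2
    -- Exchange factor 0 first, weighted by the remaining mass of `a`, which sums to one; the
    -- difference of the other factors is weighted by `b 0`, which also sums to one.
    have hle : ∀ (y : S 0) (s : ∀ j : Fin m, S j.succ),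
        |a 0 y * ∏ j : Fin m, a j.succ (s j) - b 0 y * ∏ j : Fin m, b j.succ (s j)| ≤
          |a 0 y - b 0 y| * ∏ j : Fin m, a j.succ (s j) + b 0 y *
            |∏ j : Fin m, a j.succ (s j) - ∏ j : Fin m, b j.succ (s j)| := by
      intro y s
      have h0 : 0 ≤ ∏ j : Fin m, a j.succ (s j) :=
        Finset.prod_nonneg fun j _ => (ha j.succ).1 _
      calc _ = |(a 0 y - b 0 y) * ∏ j : Fin m, a j.succ (s j) + b 0 y *
            (∏ j : Fin m, a j.succ (s j) - ∏ j : Fin m, b j.succ (s j))| := by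
            congr 1
            ring
        _ ≤ _ := (abs_add_le _ _).trans (by
            rw [abs_mul, abs_mul, abs_of_nonneg h0, abs_of_nonneg ((hb 0).1 y)])
    calc _ ≤ ∑ y, ∑ s : ∀ j : Fin m, S j.succ, (|a 0 y - b 0 y| * ∏ j : Fin m, a j.succ (s j) +
            b 0 y * |∏ j : Fin m, a j.succ (s j) - ∏ j : Fin m, b j.succ (s j)|) :=
          Finset.sum_le_sum fun y _ => Finset.sum_le_sum fun s _ => hle y s
      _ = ∑ y, |a 0 y - b 0 y| + ∑ s : ∀ j : Fin m, S j.succ,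
            |∏ j : Fin m, a j.succ (s j) - ∏ j : Fin m, b j.succ (s j)| := by
          simp only [Finset.sum_add_distrib, ← Finset.mul_sum, hA, mul_one]
          rw [← Finset.sum_mul, (hb 0).2, one_mul]
      _ ≤ _ := by gcongr

end ProductMass

/-! ### Bellman recursion and comparison of values in two MDPs -/

section MDP

variable {m n l : ℕ} {S : Fin m → Type uS} {A : Type uA} {X : Fin n → Type uX}
variable [∀ j, Fintype (S j)] {G : FactoredGraph S A X l} {C : ℝ} {σ : ℝ≥0}

/-- The state-action pair in state `s` with `d + 1` steps to go when `μ` is followed. -/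
def FactoredGraph.pairToGo (G : FactoredGraph S A X l) (hτ : 0 < G.τ) (μ : G.Policy) (d : ℕ)
    (s : ∀ j, S j) : ∀ i, X i :=
  G.split (s, μ ⟨G.τ - (d + 1), Nat.sub_lt hτ d.succ_pos⟩ s)

namespace FactoredMDP

theorem trans_mem (M : FactoredMDP G C σ) (x : ∀ i, X i) :
    M.trans x ∈ stdSimplex ℝ (∀ j, S j) := by
  refine ⟨fun s => Finset.prod_nonneg fun j _ => (M.P_mem j _).1 _, ?_⟩
  simp only [trans]
  rw [sum_pi_prod fun j => M.P j ((G.ZP j).restrict x)]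
  exact Finset.prod_eq_one fun j _ => (M.P_mem j _).2

/-- The factors other than the `j`-th sum to one. This is why observations at different `x` with the
same scope variable can be pooled. -/
theorem sum_trans_mul_apply (M : FactoredMDP G C σ) (x : ∀ i, X i) (j : Fin m) (g : S j → ℝ) :
    ∑ s, M.trans x s * g (s j) = ∑ y, M.P j ((G.ZP j).restrict x) y * g y := by
  classical
  let h : ∀ i, S i → ℝ := Function.update (fun _ _ => 1) j g
  have h1 : ∀ s : ∀ i, S i, M.trans x s * g (s j) =
      ∏ i, M.P i ((G.ZP i).restrict x) (s i) * h i (s i) := by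
    intro s
    rw [Finset.prod_mul_distrib, trans]
    congr 1
    rw [Fintype.prod_eq_single j]
    · simp [h]
    · intro i hi
      simp [h, hi]
  simp only [h1]
  rw [sum_pi_prod fun i y => M.P i ((G.ZP i).restrict x) y * h i y, Fintype.prod_eq_single j]
  · simp [h]
  · intro i hi
    simp [h, hi, (M.P_mem i _).2]

theorem meanReward_mem (M : FactoredMDP G C σ) (x : ∀ i, X i) :
    M.meanReward x ∈ Set.Icc 0 C :=
  M.R_total x

/-- The value function, indexed by the number of steps to go and defined by the Bellman
recursion. -/
noncomputable def valueToGo (M : FactoredMDP G C σ) (hτ : 0 < G.τ) (μ : G.Policy) : ℕ → (∀ j, S j) → ℝ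
  | 0 => fun _ => 0
  | d + 1 => fun s => M.meanReward (G.pairToGo hτ μ d s) +
      ∑ v, M.trans (G.pairToGo hτ μ d s) v * valueToGo M hτ μ d v

theorem valueToGo_mem (M : FactoredMDP G C σ) (hτ : 0 < G.τ) (μ : G.Policy) (d : ℕ)
    (s : ∀ j, S j) : M.valueToGo hτ μ d s ∈ Set.Icc 0 (C * d) := by
  induction d generalizing s with
  | zero => simp [valueToGo]
  | succ d ih =>
    have hr := M.meanReward_mem (G.pairToGo hτ μ d s)
    have ht := M.trans_mem (G.pairToGo hτ μ d s)
    rw [valueToGo]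
    refine ⟨add_nonneg hr.1 (Finset.sum_nonneg fun v _ => mul_nonneg (ht.1 v) (ih v).1), ?_⟩
    have h1 : ∑ v, M.trans (G.pairToGo hτ μ d s) v * M.valueToGo hτ μ d v ≤ C * d := by
      calc _ ≤ ∑ v, M.trans (G.pairToGo hτ μ d s) v * (C * d) :=
            Finset.sum_le_sum fun v _ => mul_le_mul_of_nonneg_left (ih v).2 (ht.1 v)
        _ = C * d := by rw [← Finset.sum_mul, ht.2, one_mul]
    push_cast
    linarith [hr.2]

/-- Interpolates between the Bellman recursion (`e = 0`) and the sum over the state laws (`e = τ -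
i`): each step unfolds the recursion once under the law of the current state. -/
theorem sum_stateLaw_add (M : FactoredMDP G C σ) (hτ : 0 < G.τ) (μ : G.Policy) (i : Fin G.τ)
    (s : ∀ j, S j) (e : ℕ) (he : i + e ≤ G.τ) :
    M.valueToGo hτ μ (G.τ - i) s =
      (∑ e' ∈ Finset.range e, ∑ v, M.stateLaw μ i s e' v *
        M.meanReward (G.pairToGo hτ μ (G.τ - i - e' - 1) v)) +
      ∑ v, M.stateLaw μ i s e v * M.valueToGo hτ μ (G.τ - i - e) v := by
  classical
  induction e with
  | zero => simp [stateLaw]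
  | succ e ih =>
    rw [ih (by omega), Finset.sum_range_succ, add_assoc]
    congr 1
    have hd : G.τ - i - e = (G.τ - i - (e + 1)) + 1 := by omega
    have hd' : G.τ - i - e - 1 = G.τ - i - (e + 1) := by omega
    have hlt : (i : ℕ) + e < G.τ := by omega
    rw [hd', hd]
    have hpair : ∀ v, G.split (v, μ ⟨(i : ℕ) + e, hlt⟩ v) =
        G.pairToGo hτ μ (G.τ - i - (e + 1)) v := by
      intro v
      simp only [FactoredGraph.pairToGo]
      congr 4
      omega
    simp only [valueToGo, stateLaw, hlt, dif_pos, hpair, mul_add, Finset.sum_add_distrib,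
      Finset.sum_mul, Finset.mul_sum]
    congr 1
    rw [Finset.sum_comm]
    simp only [mul_assoc]

theorem value_eq_valueToGo (M : FactoredMDP G C σ) (hτ : 0 < G.τ) (μ : G.Policy) (i : Fin G.τ)
    (s : ∀ j, S j) : M.value μ i s = M.valueToGo hτ μ (G.τ - i) s := by
  rw [M.sum_stateLaw_add hτ μ i s (G.τ - i) (by omega)]
  simp only [Nat.sub_self, valueToGo, mul_zero, Finset.sum_const_zero, add_zero, value]
  refine Finset.sum_bij (fun j _ => (j : ℕ) - i) ?_ ?_ ?_ ?_
  · intro j hj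
    rw [Finset.mem_Ici, Fin.le_def] at hj
    rw [Finset.mem_range]
    omega
  · intro j hj j' hj' h
    rw [Finset.mem_Ici, Fin.le_def] at hj hj'
    ext
    omega
  · intro e he
    rw [Finset.mem_range] at he
    refine ⟨⟨i + e, by omega⟩, ?_, ?_⟩
    · rw [Finset.mem_Ici, Fin.le_def]
      simp
    · simp
  · intro j hj
    rw [Finset.mem_Ici, Fin.le_def] at hj
    refine Finset.sum_congr rfl fun v _ => ?_
    congr 2
    simp only [FactoredGraph.pairToGo]
    congr 4
    ext
    simp only
    omega

theorem episodeValue_eq (M : FactoredMDP G C σ) (hτ : 0 < G.τ) (μ : G.Policy) :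
    M.episodeValue μ = ∑ s, M.ρ s * M.valueToGo hτ μ G.τ s := by
  simp only [episodeValue, dif_pos hτ, M.value_eq_valueToGo hτ, Nat.sub_zero]

/-- A bound on the error of the value function of an MDP whose one-step errors, as compared with
`M`, are bounded by `w`. It is clipped at the trivial bound. -/
noncomputable def clippedGap (M : FactoredMDP G C σ) (hτ : 0 < G.τ) (μ : G.Policy) (w : (∀ i, X i) → ℝ) :
    ℕ → (∀ j, S j) → ℝ
  | 0 => fun _ => 0
  | d + 1 => fun s => min (C * (d + 1)) (w (G.pairToGo hτ μ d s) +
      ∑ v, M.trans (G.pairToGo hτ μ d s) v * clippedGap M hτ μ w d v)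

theorem clippedGap_mem (M : FactoredMDP G C σ) (hC : 0 ≤ C) (hτ : 0 < G.τ) (μ : G.Policy)
    {w : (∀ i, X i) → ℝ} (hw : ∀ x, 0 ≤ w x) (d : ℕ) (s : ∀ j, S j) :
    M.clippedGap hτ μ w d s ∈ Set.Icc 0 (C * d) := by
  induction d generalizing s with
  | zero => simp [clippedGap]
  | succ d ih =>
    rw [clippedGap]
    refine ⟨le_min (by positivity) (add_nonneg (hw _) (Finset.sum_nonneg fun v _ =>
      mul_nonneg ((M.trans_mem _).1 v) (ih v).1)), ?_⟩
    push_cast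
    exact min_le_left _ _

theorem clippedGap_succ_le (M : FactoredMDP G C σ) (hτ : 0 < G.τ) (μ : G.Policy)
    (w : (∀ i, X i) → ℝ) (d : ℕ) (s : ∀ j, S j) :
    M.clippedGap hτ μ w (d + 1) s ≤ w (G.pairToGo hτ μ d s) +
      ∑ v, M.trans (G.pairToGo hτ μ d s) v * M.clippedGap hτ μ w d v :=
  min_le_right _ _

/-- Write `P'V' - PV = (P' - P)V' + P(V' - V)`. In the first term `V'` has at most `τ - 1` steps to
go, hence values in `[0, C(τ - 1)]`; the second propagates the gap along the transitions of `M`,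
those that generate the data. The clip is harmless since both values lie between `0` and `C` times
the number of steps to go. -/
theorem valueToGo_sub_le_clippedGap (M M' : FactoredMDP G C σ) (hC : 0 ≤ C) (hτ : 0 < G.τ)
    (μ : G.Policy) {w : (∀ i, X i) → ℝ}
    (hw : ∀ x, M'.meanReward x - M.meanReward x +
      C * ((G.τ : ℝ) - 1) * ∑ v, |M'.trans x v - M.trans x v| ≤ w x)
    (d : ℕ) (hd : d ≤ G.τ) (s : ∀ j, S j) :
    M'.valueToGo hτ μ d s - M.valueToGo hτ μ d s ≤ M.clippedGap hτ μ w d s := by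
  induction d generalizing s with
  | zero => simp [valueToGo, clippedGap]
  | succ d ih =>
    rw [clippedGap]
    refine le_min ?_ ?_
    · have h1 := (M'.valueToGo_mem hτ μ (d + 1) s).2
      have h2 := (M.valueToGo_mem hτ μ (d + 1) s).1
      push_cast at h1
      linarith
    · simp only [valueToGo]
      set x := G.pairToGo hτ μ d s
      have hd' : (d : ℝ) ≤ (G.τ : ℝ) - 1 := by
        have : ((d + 1 : ℕ) : ℝ) ≤ G.τ := by exact_mod_cast hd
        push_cast at this
        linarith
      have h1 : ∑ v, (M'.trans x v - M.trans x v) * M'.valueToGo hτ μ d v ≤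
          C * ((G.τ : ℝ) - 1) * ∑ v, |M'.trans x v - M.trans x v| := by
        rw [Finset.mul_sum]
        refine Finset.sum_le_sum fun v _ => ?_
        have hv := M'.valueToGo_mem hτ μ d v
        calc _ ≤ |M'.trans x v - M.trans x v| * M'.valueToGo hτ μ d v :=
              mul_le_mul_of_nonneg_right (le_abs_self _) hv.1
          _ ≤ |M'.trans x v - M.trans x v| * (C * ((G.τ : ℝ) - 1)) := by
              have := hv.2
              gcongr
              exact this.trans (by gcongr)
          _ = _ := mul_comm _ _
      have h2 : ∑ v, M.trans x v * (M'.valueToGo hτ μ d v - M.valueToGo hτ μ d v) ≤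
          ∑ v, M.trans x v * M.clippedGap hτ μ w d v :=
        Finset.sum_le_sum fun v _ =>
          mul_le_mul_of_nonneg_left (ih (by omega) v) ((M.trans_mem x).1 v)
      have h3 : ∑ v, (M'.trans x v - M.trans x v) * M'.valueToGo hτ μ d v +
          ∑ v, M.trans x v * (M'.valueToGo hτ μ d v - M.valueToGo hτ μ d v) =
          ∑ v, M'.trans x v * M'.valueToGo hτ μ d v - ∑ v, M.trans x v * M.valueToGo hτ μ d v := by
        rw [← Finset.sum_add_distrib, ← Finset.sum_sub_distrib]
        exact Finset.sum_congr rfl fun v _ => by ring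
      linarith [hw x]

theorem meanReward_sub_add_le (M M' : FactoredMDP G C σ) {c : ℝ} (hc : 0 ≤ c) {x : ∀ i, X i}
    {bR : Fin l → ℝ} {bP : Fin m → ℝ}
    (hR : ∀ i, (∫ r, r ∂(M'.R i ((G.ZR i).restrict x))) -
      (∫ r, r ∂(M.R i ((G.ZR i).restrict x))) ≤ bR i)
    (hP : ∀ j, ∑ y, |M'.P j ((G.ZP j).restrict x) y - M.P j ((G.ZP j).restrict x) y| ≤ bP j) :
    M'.meanReward x - M.meanReward x + c * ∑ v, |M'.trans x v - M.trans x v| ≤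
      ∑ i, bR i + c * ∑ j, bP j := by
  refine add_le_add ?_ (mul_le_mul_of_nonneg_left ?_ hc)
  · rw [meanReward, meanReward, ← Finset.sum_sub_distrib]
    exact Finset.sum_le_sum fun i _ => hR i
  · exact (sum_abs_prod_sub_prod_le (fun j => M'.P_mem j _) (fun j => M.P_mem j _)).trans
      (Finset.sum_le_sum fun j _ => hP j)

end FactoredMDP

end MDP

/-! ### The filtration of the observations -/

section Histories

open scoped ENNReal

variable {m n l : ℕ} {S : Fin m → Type uS} {A : Type uA} {X : Fin n → Type uX}
variable {G : FactoredGraph S A X l} {Ω : Type uΩ}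

namespace Observations

/-- The history before the state at step `v` of episode `k` is observed. -/
@[reducible] def preHistory (O : Observations G Ω) (k : ℕ) (v : Fin (G.τ + 1)) :
    MeasurableSpace Ω :=
  Fin.cases (motive := fun _ => MeasurableSpace Ω) (O.episodeHistory k)
    (fun u => O.stepHistory k u) v

variable (O : Observations G Ω)

theorem episodeHistory_le_stepHistory (k : ℕ) (u : Fin G.τ) :
    O.episodeHistory k ≤ O.stepHistory k u :=
  le_sup_of_le_left (le_sup_of_le_left le_sup_left)

theorem episodeHistory_mono {k k' : ℕ} (h : k ≤ k') : O.episodeHistory k ≤ O.episodeHistory k' :=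
  iSup_le fun i => le_iSup (fun i : Fin k' =>
    (⨆ u : Fin (G.τ + 1), MeasurableSpace.comap (O.state i u) ⊤) ⊔
    (⨆ u : Fin G.τ, MeasurableSpace.comap (O.action i u) ⊤) ⊔
    (⨆ u : Fin G.τ, ⨆ j : Fin l, MeasurableSpace.comap (O.reward i u j) (borel ℝ)))
    (Fin.castLE h i)

theorem comap_le_episodeHistory {k k' : ℕ} (h : k < k') :
    (⨆ u : Fin (G.τ + 1), MeasurableSpace.comap (O.state k u) ⊤) ⊔
    (⨆ u : Fin G.τ, MeasurableSpace.comap (O.action k u) ⊤) ⊔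
    (⨆ u : Fin G.τ, ⨆ j : Fin l, MeasurableSpace.comap (O.reward k u j) (borel ℝ)) ≤
      O.episodeHistory k' :=
  le_iSup (fun i : Fin k' =>
    (⨆ u : Fin (G.τ + 1), MeasurableSpace.comap (O.state i u) ⊤) ⊔
    (⨆ u : Fin G.τ, MeasurableSpace.comap (O.action i u) ⊤) ⊔
    (⨆ u : Fin G.τ, ⨆ j : Fin l, MeasurableSpace.comap (O.reward i u j) (borel ℝ))) ⟨k, h⟩

theorem measurable_state_episodeHistory {k k' : ℕ} (h : k < k') (u : Fin (G.τ + 1)) :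
    Measurable[O.episodeHistory k', ⊤] (O.state k u) := by
  rw [measurable_iff_comap_le]
  exact le_trans (le_sup_of_le_left (le_sup_of_le_left
    (le_iSup (fun u => MeasurableSpace.comap (O.state k u) ⊤) u))) (O.comap_le_episodeHistory h)

theorem measurable_action_episodeHistory {k k' : ℕ} (h : k < k') (u : Fin G.τ) :
    Measurable[O.episodeHistory k', ⊤] (O.action k u) := by
  rw [measurable_iff_comap_le]
  exact le_trans (le_sup_of_le_left (le_sup_of_le_right
    (le_iSup (fun u => MeasurableSpace.comap (O.action k u) ⊤) u))) (O.comap_le_episodeHistory h)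

theorem measurable_reward_episodeHistory {k k' : ℕ} (h : k < k') (u : Fin G.τ) (i : Fin l) :
    Measurable[O.episodeHistory k'] (O.reward k u i) := by
  rw [BorelSpace.measurable_eq (α := ℝ), measurable_iff_comap_le]
  exact le_trans (le_sup_of_le_right (le_iSup₂_of_le u i le_rfl)) (O.comap_le_episodeHistory h)

theorem measurable_state_stepHistory (k : ℕ) {v u : Fin G.τ} (h : v ≤ u) :
    Measurable[O.stepHistory k u, ⊤] (O.state k v.castSucc) := by
  rw [measurable_iff_comap_le]
  exact le_sup_of_le_left (le_sup_of_le_left (le_sup_of_le_right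
    (le_iSup (fun v : Set.Iic u => MeasurableSpace.comap (O.state k v.1.castSucc) ⊤) ⟨v, h⟩)))

theorem measurable_action_stepHistory (k : ℕ) {v u : Fin G.τ} (h : v ≤ u) :
    Measurable[O.stepHistory k u, ⊤] (O.action k v) := by
  rw [measurable_iff_comap_le]
  exact le_sup_of_le_left (le_sup_of_le_right
    (le_iSup (fun v : Set.Iic u => MeasurableSpace.comap (O.action k v.1) ⊤) ⟨v, h⟩))

theorem measurable_reward_stepHistory (k : ℕ) {v u : Fin G.τ} (h : v < u) (i : Fin l) :
    Measurable[O.stepHistory k u] (O.reward k v i) := by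
  rw [BorelSpace.measurable_eq (α := ℝ), measurable_iff_comap_le]
  exact le_sup_of_le_right (le_iSup₂_of_le (⟨v, h⟩ : Set.Iio u) i le_rfl)

theorem measurable_state_preHistory (k : ℕ) {v v' : Fin (G.τ + 1)} (h : v < v') :
    Measurable[O.preHistory k v', ⊤] (O.state k v) := by
  induction v' using Fin.cases with
  | zero => exact absurd h (Fin.not_lt_zero _)
  | succ u =>
    have hv : v = Fin.castSucc ⟨v, lt_of_le_of_lt (Nat.lt_succ_iff.1 h) u.2⟩ := rfl
    rw [hv]
    exact O.measurable_state_stepHistory k (Nat.lt_succ_iff.1 h)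

theorem episodeHistory_le_preHistory (k : ℕ) (v : Fin (G.τ + 1)) :
    O.episodeHistory k ≤ O.preHistory k v := by
  induction v using Fin.cases with
  | zero => exact le_rfl
  | succ u => exact O.episodeHistory_le_stepHistory k u

theorem measurableSet_pair_eq {F : MeasurableSpace Ω} {k : ℕ} {u : Fin G.τ}
    (hs : Measurable[F, ⊤] (O.state k u.castSucc)) (ha : Measurable[F, ⊤] (O.action k u))
    (x : ∀ i, X i) : MeasurableSet[F] {ω | O.pair k u ω = x} := by
  have : {ω | O.pair k u ω = x} = O.state k u.castSucc ⁻¹' {(G.split.symm x).1} ∩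
      O.action k u ⁻¹' {(G.split.symm x).2} := by
    ext ω
    simp only [pair, Set.mem_ofPred_eq, Set.mem_inter_iff, Set.mem_preimage, Set.mem_singleton_iff]
    rw [← Equiv.eq_symm_apply, Prod.ext_iff]
  rw [this]
  exact MeasurableSet.inter (hs (MeasurableSpace.measurableSet_top))
    (ha (MeasurableSpace.measurableSet_top))

theorem measurableSet_pair_episodeHistory {k k' : ℕ} (h : k < k') (u : Fin G.τ) (x : ∀ i, X i) :
    MeasurableSet[O.episodeHistory k'] {ω | O.pair k u ω = x} :=
  O.measurableSet_pair_eq (O.measurable_state_episodeHistory h _)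
    (O.measurable_action_episodeHistory h _) x

theorem measurableSet_pair_stepHistory (k : ℕ) {v u : Fin G.τ} (h : v ≤ u) (x : ∀ i, X i) :
    MeasurableSet[O.stepHistory k u] {ω | O.pair k v ω = x} :=
  O.measurableSet_pair_eq (O.measurable_state_stepHistory k h)
    (O.measurable_action_stepHistory k h) x

/-- A function of finitely many state-action pairs and of a further observation with values in a
finite set is measurable if these are. -/
theorem measurable_of_pairs [∀ i, Finite (X i)] {F : MeasurableSpace Ω} {β γ : Type*} [Finite β]
    [MeasurableSpace γ] (I : Finset (ℕ × Fin G.τ))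
    (hI : ∀ q ∈ I, ∀ x, MeasurableSet[F] {ω | O.pair q.1 q.2 ω = x}) (ψ : Ω → β)
    (hψ : ∀ b, MeasurableSet[F] (ψ ⁻¹' {b})) {f : Ω → γ}
    (h : ∀ ω ω', (∀ q ∈ I, O.pair q.1 q.2 ω = O.pair q.1 q.2 ω') → ψ ω = ψ ω' → f ω = f ω') :
    Measurable[F] f := by
  refine measurable_of_factorsThrough (β := β × (I → ∀ i, X i))
    (fun ω => (ψ ω, fun q => O.pair q.1.1 q.1.2 ω)) (fun b => ?_) (fun ω ω' hω => ?_)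
  · have : (fun ω => (ψ ω, fun q : I => O.pair q.1.1 q.1.2 ω)) ⁻¹' {b} =
        ψ ⁻¹' {b.1} ∩ ⋂ q : I, {ω | O.pair q.1.1 q.1.2 ω = b.2 q} := by
      ext ω
      simp only [Set.mem_preimage, Set.mem_singleton_iff, Prod.ext_iff, funext_iff,
        Set.mem_inter_iff, Set.mem_iInter, Set.mem_ofPred_eq]
    rw [this]
    exact (hψ _).inter (MeasurableSet.iInter fun q => hI q.1 q.2 _)
  · rw [Prod.ext_iff, funext_iff] at hω
    exact h ω ω' (fun q hq => hω.2 ⟨q, hq⟩) hω.1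

theorem stepHistory_mono (k : ℕ) {u u' : Fin G.τ} (h : u < u') :
    O.stepHistory k u ≤ O.stepHistory k u' := by
  refine sup_le (sup_le (sup_le (O.episodeHistory_le_stepHistory k u') (iSup_le fun v => ?_))
    (iSup_le fun v => ?_)) (iSup₂_le fun v i => ?_)
  · exact measurable_iff_comap_le.1 (O.measurable_state_stepHistory k (le_trans v.2 h.le))
  · exact measurable_iff_comap_le.1 (O.measurable_action_stepHistory k (le_trans v.2 h.le))
  · have := measurable_iff_comap_le.1 (O.measurable_reward_stepHistory k (lt_trans v.2 h) i)
    rwa [BorelSpace.measurable_eq (α := ℝ)] at this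

theorem stepHistory_le_episodeHistory {k k' : ℕ} (h : k < k') (u : Fin G.τ) :
    O.stepHistory k u ≤ O.episodeHistory k' := by
  refine sup_le (sup_le (sup_le (O.episodeHistory_mono h.le) (iSup_le fun v => ?_))
    (iSup_le fun v => ?_)) (iSup₂_le fun v i => ?_)
  · exact measurable_iff_comap_le.1 (O.measurable_state_episodeHistory h _)
  · exact measurable_iff_comap_le.1 (O.measurable_action_episodeHistory h _)
  · have := measurable_iff_comap_le.1 (O.measurable_reward_episodeHistory h v i)
    rwa [BorelSpace.measurable_eq (α := ℝ)] at this

/-- A product of adapted factors, each of which has conditional mean at most one, has mean at most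
one. -/
theorem lintegral_prod_prod_le [mΩ : MeasurableSpace Ω] {Pr : Measure Ω} [IsProbabilityMeasure Pr]
    {Y : ℕ → Fin (G.τ + 1) → Ω → ℝ≥0∞}
    (h : ∀ k v, CondMeanLEOne (O.preHistory k v) Pr (Y k v))
    (hY : ∀ k v v', v < v' → Measurable[O.preHistory k v'] (Y k v))
    (hY' : ∀ k v k', k < k' → Measurable[O.episodeHistory k'] (Y k v)) (N : ℕ) :
    ∫⁻ ω, ∏ k ∈ Finset.range N, ∏ v, Y k v ω ∂Pr ≤ 1 := by
  -- The product over one episode is itself a factor with conditional mean at most one given the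
  -- history before the episode, so the same lemma applies again across episodes.
  have h1 : ∀ k, CondMeanLEOne (O.episodeHistory k) Pr fun ω => ∏ v, Y k v ω := fun k f hf =>
    lintegral_mul_prod_le (h k) (hY k) fun v =>
      hf.mono (O.episodeHistory_le_preHistory k v) le_rfl
  have h2 := lintegral_mul_prod_le (P := Pr) (F := fun k : Fin N => O.episodeHistory k)
    (Y := fun k ω => ∏ v, Y k v ω) (fun k => h1 k)
    (fun i j hij => Finset.measurable_fun_prod _ fun v _ => hY' i v j hij) (f := fun _ => 1)
    (fun _ => measurable_const)
  simp only [one_mul, lintegral_const, measure_univ, mul_one] at h2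
  simpa only [Finset.prod_range] using h2

end Observations

variable [∀ j, Fintype (S j)] {C : ℝ} {σ : ℝ≥0} [mΩ : MeasurableSpace Ω] {Pr : Measure Ω}
variable {M : FactoredMDP G C σ} {π : ℕ → Ω → G.Policy} {O : Observations G Ω}

namespace IsInteraction

theorem comap_state_le (hO : IsInteraction Pr M π O) (k : ℕ) (u : Fin (G.τ + 1)) :
    MeasurableSpace.comap (O.state k u) ⊤ ≤ mΩ :=
  (hO.state_meas k u).comap_le

theorem comap_action_le (hO : IsInteraction Pr M π O) (k : ℕ) (u : Fin G.τ) :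
    MeasurableSpace.comap (O.action k u) ⊤ ≤ mΩ :=
  (hO.action_meas k u).comap_le

theorem comap_reward_le (hO : IsInteraction Pr M π O) (k : ℕ) (u : Fin G.τ) (i : Fin l) :
    MeasurableSpace.comap (O.reward k u i) (borel ℝ) ≤ mΩ := by
  have := (hO.reward_meas k u i).comap_le
  rwa [BorelSpace.measurable_eq (α := ℝ)] at this

theorem episodeHistory_le (hO : IsInteraction Pr M π O) (k : ℕ) : O.episodeHistory k ≤ mΩ :=
  iSup_le fun k' => sup_le (sup_le (iSup_le fun u => hO.comap_state_le k' u)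
    (iSup_le fun u => hO.comap_action_le k' u))
    (iSup₂_le fun u i => hO.comap_reward_le k' u i)

theorem stepHistory_le (hO : IsInteraction Pr M π O) (k : ℕ) (u : Fin G.τ) :
    O.stepHistory k u ≤ mΩ :=
  sup_le (sup_le (sup_le (hO.episodeHistory_le k) (iSup_le fun _ => hO.comap_state_le k _))
    (iSup_le fun _ => hO.comap_action_le k _)) (iSup₂_le fun _ i => hO.comap_reward_le k _ i)

theorem preHistory_le (hO : IsInteraction Pr M π O) (k : ℕ) (v : Fin (G.τ + 1)) :
    O.preHistory k v ≤ mΩ := by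
  induction v using Fin.cases with
  | zero => exact hO.episodeHistory_le k
  | succ u => exact hO.stepHistory_le k u

end IsInteraction

end Histories

/-! ### Deviations at a given number of visits -/

section Concentration

open scoped ENNReal

/-- An event of `F` may decide whether the factor is `Y` or `1`: split the test function over `B`
and its complement. -/
theorem CondMeanLEOne.indicator_add {Ω : Type*} {F m : MeasurableSpace Ω} (hF : F ≤ m)
    {P : Measure Ω} {Y : Ω → ℝ≥0∞} (hY : CondMeanLEOne F P Y) {B : Set Ω}
    (hB : MeasurableSet[F] B) :
    CondMeanLEOne F P (B.indicator Y + Bᶜ.indicator 1) := by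
  intro f hf
  have hfm : Measurable f := hf.mono hF le_rfl
  have h1 : ∀ ω, f ω * (B.indicator Y + Bᶜ.indicator 1 : Ω → ℝ≥0∞) ω =
      B.indicator f ω * Y ω + Bᶜ.indicator f ω := by
    intro ω
    by_cases hω : ω ∈ B <;> simp [hω]
  simp only [h1]
  rw [lintegral_add_right _ (hfm.indicator (hF _ hB).compl)]
  have h2 := hY (B.indicator f) (hf.indicator hB)
  calc _ ≤ ∫⁻ ω, B.indicator f ω ∂P + ∫⁻ ω, Bᶜ.indicator f ω ∂P := by gcongr
    _ = ∫⁻ ω, f ω ∂P := by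
      rw [← lintegral_add_right _ (hfm.indicator (hF _ hB).compl)]
      exact lintegral_congr fun ω => by
        by_cases hω : ω ∈ B <;> simp [hω]

variable {m n l : ℕ} {S : Fin m → Type uS} {A : Type uA} {X : Fin n → Type uX}
variable {G : FactoredGraph S A X l} {Ω : Type uΩ}

namespace Observations

variable (O : Observations G Ω)

open scoped Classical in
/-- The number of steps before step `u` of episode `k` at which the scope variable was `z`. -/
noncomputable def visitsBefore (k : ℕ) (u : Fin G.τ) (ω : Ω) (Z : Finset (Fin n))
    (z : ScopeSet X Z) : ℕ :=
  ((O.visits (k + 1) ω Z z).filter fun q => q.1 < k ∨ q.1 = k ∧ q.2 < u).card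

theorem mem_visits {k : ℕ} {ω : Ω} {Z : Finset (Fin n)} {z : ScopeSet X Z} {p : ℕ × Fin G.τ} :
    p ∈ O.visits k ω Z z ↔ p.1 < k ∧ Z.restrict (O.pair p.1 p.2 ω) = z := by
  simp [visits]

theorem card_visits_le (k : ℕ) (ω : Ω) (Z : Finset (Fin n))
    (z : ScopeSet X Z) : (O.visits k ω Z z).card ≤ k * G.τ := by
  classical
  refine (Finset.card_filter_le _ _).trans ?_
  simp

theorem visits_congr {k : ℕ} {ω ω' : Ω} {Z : Finset (Fin n)} {z : ScopeSet X Z}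
    (h : ∀ k' < k, ∀ u, O.pair k' u ω = O.pair k' u ω') :
    O.visits k ω Z z = O.visits k ω' Z z := by
  ext p
  simp only [mem_visits]
  refine and_congr_right fun hp => ?_
  rw [h p.1 hp]

/-- A visit is among the first `n'` ones exactly if it precedes an episode start with count `n'`.
The first condition is known at the time of the visit, whereas the second refers to the future; this
is what makes the freezing of the product predictable. -/
theorem visitsBefore_lt_iff {k n' : ℕ} {u : Fin G.τ} {ω : Ω} {Z : Finset (Fin n)}
    {z : ScopeSet X Z} {K : ℕ} (hK : (O.visits K ω Z z).card = n')
    (hz : Z.restrict (O.pair k u ω) = z) : O.visitsBefore k u ω Z z < n' ↔ k < K := by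
  classical
  subst hK
  constructor
  · intro h
    by_contra! hk
    refine absurd (Finset.card_le_card (s := O.visits K ω Z z) ?_) (not_le.2 h)
    intro q hq
    rw [mem_visits] at hq
    rw [Finset.mem_filter, mem_visits]
    exact ⟨⟨by omega, hq.2⟩, Or.inl (by omega)⟩
  · intro hk
    refine Finset.card_lt_card (Finset.ssubset_iff_of_subset ?_ |>.2 ⟨(k, u), ?_, ?_⟩)
    · intro q hq
      rw [Finset.mem_filter, mem_visits] at hq
      rw [mem_visits]
      exact ⟨by omega, hq.1.2⟩
    · exact O.mem_visits.2 ⟨hk, hz⟩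
    · simp

theorem measurableSet_visitsBefore_lt [∀ i, Finite (X i)] (k : ℕ) (u : Fin G.τ)
    (Z : Finset (Fin n)) (z : ScopeSet X Z) (n' : ℕ) :
    MeasurableSet[O.stepHistory k u]
      {ω | Z.restrict (O.pair k u ω) = z ∧ O.visitsBefore k u ω Z z < n'} := by
  classical
  refine @measurableSet_setOfPred _ (O.stepHistory k u) _ |>.2 ?_
  refine O.measurable_of_pairs
    ((Finset.range (k + 1) ×ˢ Finset.univ).filter fun q => q.1 < k ∨ q.1 = k ∧ q.2 ≤ u)
    (fun q hq x => ?_) (fun _ => ()) (fun b => by simp) (fun ω ω' h _ => ?_)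
  · rw [Finset.mem_filter] at hq
    obtain ⟨q1, q2⟩ := q
    obtain h | ⟨rfl, h⟩ := hq.2
    · exact O.episodeHistory_le_stepHistory k u _ (O.measurableSet_pair_episodeHistory h _ x)
    · exact O.measurableSet_pair_stepHistory _ h x
  · have h1 : O.pair k u ω = O.pair k u ω' := h (k, u) (by simp)
    have h2 : O.visitsBefore k u ω Z z = O.visitsBefore k u ω' Z z := by
      rw [visitsBefore, visitsBefore]
      congr 1
      ext q
      simp only [Finset.mem_filter, mem_visits]
      refine ⟨fun hq => ?_, fun hq => ?_⟩ <;>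
      · have := h q (by
          simp only [Finset.mem_filter, Finset.mem_product, Finset.mem_range, Finset.mem_univ,
            and_true]
          exact ⟨hq.1.1, hq.2.imp_right fun h => ⟨h.1, h.2.le⟩⟩)
        simpa [this] using hq
    rw [h1, h2]

theorem measurable_trans_pair [∀ j, Fintype (S j)] {C : ℝ} {σ : ℝ≥0} [∀ i, Finite (X i)]
    (M : FactoredMDP G C σ) (k : ℕ) (u : Fin G.τ) (v : ∀ j, S j) :
    Measurable[O.stepHistory k u] fun ω => M.trans (O.pair k u ω) v :=
  O.measurable_of_pairs {(k, u)}
    (fun q hq x => by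
      rw [Finset.mem_singleton] at hq
      subst hq
      exact O.measurableSet_pair_stepHistory k le_rfl x)
    (fun _ => ()) (fun b => by simp) (fun ω ω' h _ => by
      have := h (k, u) (Finset.mem_singleton_self _)
      simp only at this
      rw [this])

variable [mΩ : MeasurableSpace Ω] {Pr : Measure Ω}

/-- A concentration inequality for the sum of a sub-Gaussian score over all the visits to `z`, at
those starts of episodes at which there have been exactly `n'` visits. -/
theorem measure_sum_visits_ge_le [IsProbabilityMeasure Pr] [∀ i, Finite (X i)]
    (hle : ∀ k, O.episodeHistory k ≤ mΩ)
    {Z : Finset (Fin n)} {z : ScopeSet X Z} {ξ : ℕ → Fin G.τ → Ω → ℝ}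
    (hξ1 : ∀ k u u', u < u' → Measurable[O.stepHistory k u'] (ξ k u))
    (hξ2 : ∀ k u k', k < k' → Measurable[O.episodeHistory k'] (ξ k u))
    (hξ : ∀ k u (t : ℝ) (B : Set Ω), MeasurableSet[O.stepHistory k u] B →
      (∀ ω ∈ B, Z.restrict (O.pair k u ω) = z) → CondMeanLEOne (O.stepHistory k u) Pr
        (B.indicator (fun ω => ENNReal.ofReal (Real.exp (t * ξ k u ω - t ^ 2 / 2))) +
          Bᶜ.indicator 1))
    (N n' : ℕ) {r : ℝ} (hr : 0 ≤ r) :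
    Pr {ω | ∃ k ≤ N, (O.visits k ω Z z).card = n' ∧
        n' * r ≤ ∑ p ∈ O.visits k ω Z z, ξ p.1 p.2 ω} ≤
      ENNReal.ofReal (Real.exp (-(n' * r ^ 2 / 2))) := by
  classical
  -- Only the first `n'` visits to `z` contribute an exponential factor; every other step
  -- contributes `1`.
  let B : ℕ → Fin G.τ → Set Ω := fun k u =>
    {ω | Z.restrict (O.pair k u ω) = z ∧ O.visitsBefore k u ω Z z < n'}
  let f : ℕ → Fin G.τ → Ω → ℝ≥0∞ := fun k u =>
    (B k u).indicator (fun ω => ENNReal.ofReal (Real.exp (r * ξ k u ω - r ^ 2 / 2))) +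
      (B k u)ᶜ.indicator 1
  -- The index is shifted by one: slot `u.succ` holds the factor of what is observed after the
  -- action at step `u`, and slot `0`, the draw of the initial state, holds `1`.
  let Y : ℕ → Fin (G.τ + 1) → Ω → ℝ≥0∞ := fun k v =>
    Fin.cases (motive := fun _ => Ω → ℝ≥0∞) (fun _ => 1) (f k) v
  have hB : ∀ k u, MeasurableSet[O.stepHistory k u] (B k u) := fun k u =>
    O.measurableSet_visitsBefore_lt k u Z z n'
  have hfm : ∀ k u (F : MeasurableSpace Ω), O.stepHistory k u ≤ F → Measurable[F] (ξ k u) →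
      Measurable[F] (f k u) := by
    intro k u F hF hm
    refine Measurable.add (Measurable.indicator ?_ (hF _ (hB k u)))
      (Measurable.indicator measurable_const (hF _ (hB k u)).compl)
    exact ENNReal.measurable_ofReal.comp
      (Real.measurable_exp.comp ((hm.const_mul r).sub_const _))
  have hprod := O.lintegral_prod_prod_le (Pr := Pr) (Y := Y) (fun k v => by
      induction v using Fin.cases with
      | zero => exact condMeanLEOne_one _ _
      | succ u => exact hξ k u r (B k u) (hB k u) fun ω hω => hω.1)
    (fun k v v' h => by
      induction v' using Fin.cases with
      | zero => exact absurd h (Fin.not_lt_zero _)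
      | succ u' =>
        induction v using Fin.cases with
        | zero => exact measurable_const
        | succ u =>
          have h' : u < u' := Fin.succ_lt_succ_iff.1 h
          exact hfm k u _ (O.stepHistory_mono k h') (hξ1 k u u' h'))
    (fun k v k' h => by
      induction v using Fin.cases with
      | zero => exact measurable_const
      | succ u => exact hfm k u _ (O.stepHistory_le_episodeHistory h u) (hξ2 k u k' h)) N
  have hY : ∀ ω, ∏ k ∈ Finset.range N, ∏ v, Y k v ω = ∏ k ∈ Finset.range N, ∏ u, f k u ω := by
    intro ω
    refine Finset.prod_congr rfl fun k _ => ?_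
    rw [Fin.prod_univ_succ]
    simp [Y]
  simp only [hY] at hprod
  have hmeas : Measurable fun ω => ∏ k ∈ Finset.range N, ∏ u, f k u ω :=
    Finset.measurable_fun_prod _ fun k _ => Finset.measurable_fun_prod _ fun u _ => hfm k u mΩ
      ((O.stepHistory_le_episodeHistory k.lt_succ_self u).trans (hle _))
      ((hξ2 k u (k + 1) k.lt_succ_self).mono (hle _) le_rfl)
  set a : ℝ := n' * r ^ 2 / 2 with ha
  have hsub : {ω | ∃ k ≤ N, (O.visits k ω Z z).card = n' ∧
      n' * r ≤ ∑ p ∈ O.visits k ω Z z, ξ p.1 p.2 ω} ⊆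
      {ω | ENNReal.ofReal (Real.exp a) ≤ ∏ k ∈ Finset.range N, ∏ u, f k u ω} := by
    rintro ω ⟨K, hK, hcard, hsum⟩
    -- If the count is `n'` at the start of episode `K`, the active steps are exactly the visits
    -- before `K`, so the product up to `N` already has its final value there. One Markov inequality
    -- thus covers all `k ≤ N`.
    have hf : ∀ k u, f k u ω = if (k, u) ∈ O.visits K ω Z z then
        ENNReal.ofReal (Real.exp (r * ξ k u ω - r ^ 2 / 2)) else 1 := by
      intro k u
      have hiff : ω ∈ B k u ↔ (k, u) ∈ O.visits K ω Z z := by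
        rw [mem_visits]
        constructor
        · rintro ⟨h1, h2⟩
          exact ⟨(O.visitsBefore_lt_iff hcard h1).1 h2, h1⟩
        · rintro ⟨h1, h2⟩
          exact ⟨h2, (O.visitsBefore_lt_iff hcard h2).2 h1⟩
      by_cases h : (k, u) ∈ O.visits K ω Z z
      · have h' := hiff.2 h
        simp [f, h, h']
      · have h' := mt hiff.1 h
        simp [f, h, h']
    have hprod' : ∏ k ∈ Finset.range N, ∏ u, f k u ω =
        ENNReal.ofReal (Real.exp (r * ∑ p ∈ O.visits K ω Z z, ξ p.1 p.2 ω - n' * (r ^ 2 / 2))) := by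
      simp only [hf]
      rw [← Finset.prod_product' (Finset.range N) Finset.univ fun k u =>
        if (k, u) ∈ O.visits K ω Z z then
          ENNReal.ofReal (Real.exp (r * ξ k u ω - r ^ 2 / 2)) else 1]
      simp only [Prod.mk.eta]
      rw [← Finset.prod_filter, Finset.mul_sum, ← hcard, ← nsmul_eq_mul, ← Finset.sum_const,
        ← Finset.sum_sub_distrib, Real.exp_sum,
        ENNReal.ofReal_prod_of_nonneg fun _ _ => (Real.exp_pos _).le]
      refine Finset.prod_congr ?_ fun _ _ => rfl
      ext p
      simp only [Finset.mem_filter, Finset.mem_product, Finset.mem_range, Finset.mem_univ,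
        and_true, and_iff_right_iff_imp, mem_visits]
      exact fun h => lt_of_lt_of_le h.1 hK
    rw [Set.mem_ofPred_eq, hprod']
    refine ENNReal.ofReal_le_ofReal (Real.exp_le_exp.2 ?_)
    have := mul_le_mul_of_nonneg_left hsum hr
    rw [ha]
    linarith
  have hpos : ENNReal.ofReal (Real.exp a) ≠ 0 := by simp [Real.exp_pos]
  calc _ ≤ _ := measure_mono hsub
    _ ≤ (∫⁻ ω, ∏ k ∈ Finset.range N, ∏ u, f k u ω ∂Pr) / ENNReal.ofReal (Real.exp a) :=
      meas_ge_le_lintegral_div hmeas.aemeasurable hpos ENNReal.ofReal_ne_top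
    _ ≤ 1 / ENNReal.ofReal (Real.exp a) := by gcongr
    _ = ENNReal.ofReal (Real.exp (-a)) := by
      rw [Real.exp_neg, ENNReal.ofReal_inv_of_pos (Real.exp_pos _), one_div]

end Observations

end Concentration

/-! ### The confidence sets contain the true MDP -/

section Confidence

open scoped ENNReal

variable {m n l : ℕ} {S : Fin m → Type uS} {A : Type uA} {X : Fin n → Type uX}
variable {G : FactoredGraph S A X l} {Ω : Type uΩ}
variable [∀ j, Fintype (S j)] {C : ℝ} [mΩ : MeasurableSpace Ω] {Pr : Measure Ω}
variable {O : Observations G Ω}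

theorem IsRewardLaw.lintegral_exp_le_one {ν : Measure ℝ} (h : IsRewardLaw C 1 ν) (t : ℝ) :
    ∫⁻ r, ENNReal.ofReal (Real.exp (t * (r - ∫ r', r' ∂ν) - t ^ 2 / 2)) ∂ν ≤ 1 := by
  have h1 := h.subgaussian.mgf_le t
  have hint := h.subgaussian.integrable_exp_mul t
  simp only [mgf, one_pow, NNReal.coe_one, one_mul] at h1
  simp only [sub_eq_add_neg _ (t ^ 2 / 2), Real.exp_add]
  rw [← ofReal_integral_eq_lintegral_ofReal (hint.mul_const _)
    (Filter.Eventually.of_forall fun r => by positivity), integral_mul_const,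
    ENNReal.ofReal_le_one, Real.exp_neg, ← div_eq_mul_inv]
  exact div_le_one_of_le₀ h1 (Real.exp_pos _).le

namespace IsInteraction

theorem measure_sum_reward_ge_le [IsProbabilityMeasure Pr] [∀ i, Finite (X i)]
    {M : FactoredMDP G C 1} {π : ℕ → Ω → G.Policy} (hO : IsInteraction Pr M π O) (i : Fin l)
    (z : ScopeSet X (G.ZR i)) {s : ℝ} (hs : s ^ 2 = 1) (N n' : ℕ) {r : ℝ} (hr : 0 ≤ r) :
    Pr {ω | ∃ k ≤ N, (O.visits k ω (G.ZR i) z).card = n' ∧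
        n' * r ≤ ∑ p ∈ O.visits k ω (G.ZR i) z,
          s * (O.reward p.1 p.2 i ω - ∫ r', r' ∂(M.R i z))} ≤
      ENNReal.ofReal (Real.exp (-(n' * r ^ 2 / 2))) := by
  have := (M.R_law i z).prob
  refine O.measure_sum_visits_ge_le (ξ := fun k u ω => s * (O.reward k u i ω -
    ∫ r', r' ∂(M.R i z))) hO.episodeHistory_le
    (fun k u u' h => ((O.measurable_reward_stepHistory k h i).sub_const _).const_mul s)
    (fun k u k' h => ((O.measurable_reward_episodeHistory h u i).sub_const _).const_mul s)
    (fun k u t B hB hBz => ?_) N n' hr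
  have hψ : Measurable fun r => ENNReal.ofReal (Real.exp
      (t * (s * (r - ∫ r', r' ∂(M.R i z))) - t ^ 2 / 2)) := by fun_prop
  refine condMeanLEOne_exp_of_law (hO.stepHistory_le k u) (hO.reward_meas k u i) hB
    (κ := fun ω => M.R i ((G.ZR i).restrict (O.pair k u ω))) (ν := M.R i z)
    (fun ω hω => by rw [hBz ω hω]) hψ ?_ (hO.reward_law k u i)
  have h1 := (M.R_law i z).lintegral_exp_le_one (t * s)
  rw [mul_pow, hs, mul_one] at h1
  simpa only [← mul_assoc] using h1

theorem measure_abs_sum_reward_ge_le [IsProbabilityMeasure Pr] [∀ i, Finite (X i)]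
    {M : FactoredMDP G C 1} {π : ℕ → Ω → G.Policy} (hO : IsInteraction Pr M π O) (i : Fin l)
    (z : ScopeSet X (G.ZR i)) (N n' : ℕ) {r : ℝ} (hr : 0 ≤ r) :
    Pr {ω | ∃ k ≤ N, (O.visits k ω (G.ZR i) z).card = n' ∧
        n' * r ≤ |∑ p ∈ O.visits k ω (G.ZR i) z,
          (O.reward p.1 p.2 i ω - ∫ r', r' ∂(M.R i z))|} ≤
      ENNReal.ofReal (2 * Real.exp (-(n' * r ^ 2 / 2))) := by
  rw [two_mul, ENNReal.ofReal_add (Real.exp_pos _).le (Real.exp_pos _).le]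
  refine le_trans (measure_mono ?_) ((measure_union_le _ _).trans (add_le_add
    (hO.measure_sum_reward_ge_le i z (s := 1) (by norm_num) N n' hr)
    (hO.measure_sum_reward_ge_le i z (s := -1) (by norm_num) N n' hr)))
  rintro ω ⟨k, hk, hcard, h⟩
  rcases le_abs.1 h with h | h
  · exact Or.inl ⟨k, hk, hcard, by simpa only [one_mul] using h⟩
  · refine Or.inr ⟨k, hk, hcard, ?_⟩
    rwa [← Finset.mul_sum, neg_one_mul]

theorem measurableSet_state_eq {σ : ℝ≥0} {M : FactoredMDP G C σ} {π : ℕ → Ω → G.Policy}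
    (hO : IsInteraction Pr M π O) (k : ℕ) (v : Fin (G.τ + 1)) (s : ∀ j, S j) :
    MeasurableSet {ω | O.state k v ω = s} :=
  hO.state_meas k v (t := {s}) MeasurableSpace.measurableSet_top

/-- A score with values in an interval of length 2 has, by Hoeffding's lemma, variance proxy 1,
which matches `t ^ 2 / 2`. The exponent is used with `-t` because the score enters as mean minus
observation. -/
theorem measure_sum_score_ge_le {σ : ℝ≥0} [IsProbabilityMeasure Pr] [∀ i, Finite (X i)]
    {M : FactoredMDP G C σ} {π : ℕ → Ω → G.Policy} (hO : IsInteraction Pr M π O) (j : Fin m)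
    (z : ScopeSet X (G.ZP j)) {ε : S j → ℝ} (hε : ∀ y, ε y ∈ Set.Icc (-1) 1) (N n' : ℕ) {r : ℝ}
    (hr : 0 ≤ r) :
    Pr {ω | ∃ k ≤ N, (O.visits k ω (G.ZP j) z).card = n' ∧
        n' * r ≤ ∑ p ∈ O.visits k ω (G.ZP j) z,
          (∑ y, M.P j z y * ε y - ε (O.state p.1 p.2.succ ω j))} ≤
      ENNReal.ofReal (Real.exp (-(n' * r ^ 2 / 2))) := by
  have hm : ∀ (F : MeasurableSpace Ω) k (u : Fin G.τ), Measurable[F, ⊤] (O.state k u.succ) →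
      Measurable[F] fun ω => ∑ y, M.P j z y * ε y - ε (O.state k u.succ ω j) := by
    intro F k u h
    refine Measurable.const_sub ?_ _
    exact @Measurable.comp _ _ _ F ⊤ _ (fun s : ∀ j, S j => ε (s j)) _ measurable_from_top h
  refine O.measure_sum_visits_ge_le (ξ := fun k u ω => ∑ y, M.P j z y * ε y -
    ε (O.state k u.succ ω j)) hO.episodeHistory_le
    (fun k u u' h => hm _ k u (O.measurable_state_preHistory k
      (Fin.succ_lt_succ_iff.2 h))) (fun k u k' h => hm _ k u
      (O.measurable_state_episodeHistory h _)) (fun k u t B hB hBz => ?_) N n' hr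
  have h1 := (condMeanLEOne_exp_of_finite (hO.stepHistory_le k u) (Y := O.state k u.succ)
    (hO.measurableSet_state_eq k _) (p := fun ω => M.trans (O.pair k u ω))
    (φ := fun _ s => ε (s j)) (O.measurable_trans_pair M k u) (fun ω => M.trans_mem _)
    (fun v => measurable_const) (a := -1) (b := 1) (fun ω s => hε _) (hO.next_law k u)
    (-t)).indicator_add (hO.stepHistory_le k u) hB
  convert h1 using 2
  refine Set.indicator_congr fun ω hω => ?_
  simp only [M.sum_trans_mul_apply]
  rw [hBz ω hω]
  congr 2
  ring

/-- The `ℓ¹` distance is the pairing of the difference with its own sign vector; a union over all `2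
^ |S j|` sign vectors leaves deviations of fixed scores. -/
theorem measure_sum_abs_ge_le {σ : ℝ≥0} [IsProbabilityMeasure Pr] [∀ i, Finite (X i)]
    {M : FactoredMDP G C σ} {π : ℕ → Ω → G.Policy} (hO : IsInteraction Pr M π O) (j : Fin m)
    (z : ScopeSet X (G.ZP j)) (N : ℕ) {n' : ℕ} (hn : 0 < n') {r : ℝ} (hr : 0 ≤ r) :
    Pr {ω | ∃ k ≤ N, (O.visits k ω (G.ZP j) z).card = n' ∧
        r ≤ ∑ y, |M.P j z y - O.empTrans k ω j z y|} ≤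
      ENNReal.ofReal (2 ^ Fintype.card (S j) * Real.exp (-(n' * r ^ 2 / 2))) := by
  classical
  let ε : (S j → Bool) → S j → ℝ := fun b y => if b y then 1 else -1
  have hε : ∀ b y, ε b y ∈ Set.Icc (-1) 1 := by
    intro b y
    simp only [ε]
    split_ifs <;> norm_num
  have hcard : ENNReal.ofReal (2 ^ Fintype.card (S j) * Real.exp (-(n' * r ^ 2 / 2))) =
      ∑ _b : S j → Bool, ENNReal.ofReal (Real.exp (-(n' * r ^ 2 / 2))) := by
    rw [Finset.sum_const, Finset.card_univ, Fintype.card_fun, Fintype.card_bool, nsmul_eq_mul,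
      ENNReal.ofReal_mul (by positivity)]
    congr 1
    rw [ENNReal.ofReal_pow (by norm_num)]
    simp
  rw [hcard]
  refine le_trans (measure_mono ?_) ((measure_iUnion_fintype_le Pr _).trans
    (Finset.sum_le_sum fun b _ => hO.measure_sum_score_ge_le j z (hε b) N n' hr))
  rintro ω ⟨k, hk, hc, h⟩
  rw [Set.mem_iUnion]
  refine ⟨fun y => decide (0 ≤ M.P j z y - O.empTrans k ω j z y), k, hk, hc, ?_⟩
  set b : S j → Bool := fun y => decide (0 ≤ M.P j z y - O.empTrans k ω j z y) with hb
  have habs : ∀ y, |M.P j z y - O.empTrans k ω j z y| =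
      (M.P j z y - O.empTrans k ω j z y) * ε b y := by
    intro y
    simp only [ε, hb, decide_eq_true_eq]
    split_ifs with h0
    · rw [abs_of_nonneg h0, mul_one]
    · rw [abs_of_neg (not_le.1 h0), mul_neg_one]
  have hn' : (n' : ℝ) ≠ 0 := by positivity
  have hemp : ∑ p ∈ O.visits k ω (G.ZP j) z, ε b (O.state p.1 p.2.succ ω j) =
      n' * ∑ y, O.empTrans k ω j z y * ε b y := by
    rw [← Finset.sum_fiberwise (O.visits k ω (G.ZP j) z) (fun p => O.state p.1 p.2.succ ω j),
      Finset.mul_sum]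
    refine Finset.sum_congr rfl fun y _ => ?_
    rw [Observations.empTrans, hc, ← mul_assoc, mul_div_cancel₀ _ hn', ← nsmul_eq_mul,
      ← Finset.sum_const]
    refine Finset.sum_congr (by congr) fun p hp => ?_
    rw [(Finset.mem_filter.1 hp).2]
  rw [Finset.sum_sub_distrib, Finset.sum_const, hc, hemp, nsmul_eq_mul, ← mul_sub,
    ← Finset.sum_sub_distrib]
  simp only [← sub_mul, ← habs]
  gcongr

end IsInteraction

/-- A lower bound on the number of episodes needed for `n` visits, when the first `2 τ` episodes
are discarded. -/
noncomputable def visitScale (τ n : ℕ) : ℝ :=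
  (2 * τ + n / τ) / 2

theorem le_visitScale (τ n : ℕ) : (τ : ℝ) ≤ visitScale τ n := by
  have : (0 : ℝ) ≤ n / τ := by positivity
  rw [visitScale]
  linarith

/-- `visitScale` is the mean of `2 τ` and `n / τ`, both of which are at most `k`. -/
theorem visitScale_le {τ n k : ℕ} (hτ : 0 < τ) (hk : 2 * τ ≤ k) (hn : n ≤ k * τ) :
    visitScale τ n ≤ k + 1 := by
  have hτ' : (0 : ℝ) < τ := by exact_mod_cast hτ
  have h1 : (n : ℝ) / τ ≤ k := by
    rw [div_le_iff₀ hτ']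
    exact_mod_cast hn
  have h2 : (2 : ℝ) * τ ≤ k := by exact_mod_cast hk
  rw [visitScale]
  linarith

/-- Since `visitScale τ n = (2τ² + n) / (2τ)`, the terms are `4τ² / (2τ² + n)²` and are dominated by
a telescoping sum. The offset `2τ²`, gained by discarding the first `2τ` episodes, makes the bound
independent of `τ`. -/
theorem sum_inv_visitScale_le {τ : ℕ} (hτ : 0 < τ) (N : ℕ) :
    ∑ n ∈ Finset.Icc 1 N, 1 / visitScale τ n ^ 2 ≤ 2 := by
  have hτ' : (0 : ℝ) < τ := by exact_mod_cast hτ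
  have key : ∑ n ∈ Finset.Icc 1 N, 1 / visitScale τ n ^ 2 ≤
      4 * (τ : ℝ) ^ 2 * (1 / (2 * (τ : ℝ) ^ 2) - 1 / (2 * (τ : ℝ) ^ 2 + N)) := by
    induction N with
    | zero => simp
    | succ N ih =>
      rw [Finset.sum_Icc_succ_top (by omega)]
      have h1 : 1 / visitScale τ (N + 1) ^ 2 = 4 * τ ^ 2 * (1 / (2 * τ ^ 2 + N + 1) ^ 2) := by
        rw [visitScale]
        push_cast
        field_simp
        ring
      have h2 : 1 / (2 * (τ : ℝ) ^ 2 + N + 1) ^ 2 ≤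
          1 / (2 * τ ^ 2 + N) - 1 / (2 * τ ^ 2 + N + 1) := by
        rw [div_sub_div _ _ (by positivity) (by positivity),
          div_le_div_iff₀ (by positivity) (by positivity)]
        nlinarith [show (0 : ℝ) ≤ 2 * τ ^ 2 + N by positivity]
      rw [h1]
      have h3 := mul_le_mul_of_nonneg_left h2 (show (0 : ℝ) ≤ 4 * τ ^ 2 by positivity)
      push_cast
      rw [← add_assoc]
      linarith
  refine key.trans ?_
  have h1 : 4 * (τ : ℝ) ^ 2 * (1 / (2 * τ ^ 2)) = 2 := by
    field_simp
    norm_num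
  have h2 : 0 ≤ 4 * (τ : ℝ) ^ 2 * (1 / (2 * τ ^ 2 + N)) := by positivity
  rw [mul_sub]
  linarith

theorem measure_biUnion_visits_le {τ : ℕ} (hτ : 0 < τ) {c : ℝ} {E : ℕ → Set Ω}
    (h : ∀ n, 0 < n → Pr (E n) ≤ ENNReal.ofReal (2 / (c * visitScale τ n) ^ 2)) (N : ℕ) :
    Pr (⋃ n ∈ Finset.Icc 1 N, E n) ≤ ENNReal.ofReal (4 / c ^ 2) := by
  refine (measure_biUnion_finset_le _ _).trans ?_
  calc _ ≤ ∑ n ∈ Finset.Icc 1 N, ENNReal.ofReal (2 / (c * visitScale τ n) ^ 2) :=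
        Finset.sum_le_sum fun n hn => h n (Finset.mem_Icc.1 hn).1
    _ = ENNReal.ofReal (2 / c ^ 2 * ∑ n ∈ Finset.Icc 1 N, 1 / visitScale τ n ^ 2) := by
        rw [← ENNReal.ofReal_sum_of_nonneg fun _ _ => by positivity, Finset.mul_sum]
        congr 1
        refine Finset.sum_congr rfl fun n _ => ?_
        rw [mul_pow, div_mul_div_comm, mul_one]
    _ ≤ _ := by
        refine ENNReal.ofReal_le_ofReal ?_
        have := mul_le_mul_of_nonneg_left (sum_inv_visitScale_le hτ N)
          (show (0 : ℝ) ≤ 2 / c ^ 2 by positivity)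
        refine this.trans (le_of_eq ?_)
        ring

namespace IsInteraction

variable [∀ i, Fintype (X i)] [IsProbabilityMeasure Pr]

/-- For `k ≥ 2τ` the scale `k + 1` dominates `visitScale` of the count, so a failure in any such
episode is a deviation beyond a radius that depends on the count alone. Then sum over the counts. -/
theorem measure_reward_confidence_le {M : FactoredMDP G C 1} {π : ℕ → Ω → G.Policy}
    (hO : IsInteraction Pr M π O) (hτ : 0 < G.τ) {δ c : ℝ} (i : Fin l) (z : ScopeSet X (G.ZR i))
    (hc : c = 4 * l * (Fintype.card (ScopeSet X (G.ZR i)) : ℝ) / δ) (hc1 : 1 ≤ c) (N : ℕ) :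
    Pr {ω | ∃ k, 2 * G.τ ≤ k ∧ k < N ∧ 0 < (O.visits k ω (G.ZR i) z).card ∧
      √(dReward G 1 δ k i / ((O.visits k ω (G.ZR i) z).card : ℝ)) <
        |(∫ r, r ∂(M.R i z)) - O.empReward k ω i z|} ≤ ENNReal.ofReal (4 / c ^ 2) := by
  have hτ' : (1 : ℝ) ≤ G.τ := by exact_mod_cast hτ
  have hcs : ∀ n', 1 ≤ c * visitScale G.τ n' := fun n' =>
    one_le_mul_of_one_le_of_one_le hc1 (hτ'.trans (le_visitScale _ _))
  -- The factor 4 makes the Chernoff exponent `2 log (c * visitScale)`, so that the probabilities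
  -- are inverse squares and summable.
  let r : ℕ → ℝ := fun n' => √(4 * Real.log (c * visitScale G.τ n') / n')
  refine le_trans (measure_mono ?_) (measure_biUnion_visits_le (c := c) hτ (E := fun n' =>
    {ω | ∃ k ≤ N, (O.visits k ω (G.ZR i) z).card = n' ∧
        n' * r n' ≤ |∑ p ∈ O.visits k ω (G.ZR i) z,
          (O.reward p.1 p.2 i ω - ∫ r', r' ∂(M.R i z))|}) (fun n' hn' => ?_) (N * G.τ))
  · rintro ω ⟨k, hk, hkN, hpos, h⟩
    simp only [Set.mem_iUnion, Finset.mem_Icc]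
    have hle := O.card_visits_le k ω (G.ZR i) z
    refine ⟨_, ⟨hpos, hle.trans (Nat.mul_le_mul_right _ hkN.le)⟩, k, hkN.le, rfl, ?_⟩
    set n' := (O.visits k ω (G.ZR i) z).card with hn'
    have hn0 : (0 : ℝ) < n' := by exact_mod_cast hpos
    have h1 : ∑ p ∈ O.visits k ω (G.ZR i) z, (O.reward p.1 p.2 i ω - ∫ r', r' ∂(M.R i z)) =
        n' * (O.empReward k ω i z - ∫ r', r' ∂(M.R i z)) := by
      rw [Finset.sum_sub_distrib, Finset.sum_const, ← hn', nsmul_eq_mul, Observations.empReward,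
        ← hn']
      field_simp
    rw [h1, abs_mul, abs_of_pos hn0, abs_sub_comm]
    refine mul_le_mul_of_nonneg_left (le_trans (Real.sqrt_le_sqrt ?_) h.le) hn0.le
    refine div_le_div_of_nonneg_right ?_ hn0.le
    have h2 : 4 * l * (Fintype.card (ScopeSet X (G.ZR i)) : ℝ) * ((k : ℝ) + 1) / δ =
        c * (k + 1) := by
      rw [hc]
      ring
    rw [dReward, h2, NNReal.coe_one, one_pow, mul_one]
    have h3 := hcs n'
    have h4 : c * visitScale G.τ n' ≤ c * (k + 1) :=
      mul_le_mul_of_nonneg_left (visitScale_le hτ hk hle) (by linarith)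
    have := Real.log_le_log (by linarith) h4
    linarith
  · refine (hO.measure_abs_sum_reward_ge_le i z N n' (Real.sqrt_nonneg _)).trans
      (ENNReal.ofReal_le_ofReal (le_of_eq ?_))
    have hn0 : (0 : ℝ) < n' := by exact_mod_cast hn'
    have h0 : 0 < c * visitScale G.τ n' := lt_of_lt_of_le one_pos (hcs n')
    have h1 : (n' : ℝ) * r n' ^ 2 / 2 = 2 * Real.log (c * visitScale G.τ n') := by
      simp only [r]
      rw [Real.sq_sqrt (div_nonneg (mul_nonneg (by norm_num) (Real.log_nonneg (hcs n')))
        hn0.le)]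
      field_simp
      ring
    rw [h1, Real.exp_neg, ← Nat.cast_two (R := ℝ), Real.exp_nat_mul, Real.exp_log h0]
    rfl

/-- As for the rewards. The factor `|S j|` in the radius beats the number of sign vectors: the bound
is `(2 / q²) ^ |S j|` with `q = c * visitScale ≥ 2`, whose base is at most one, so the power may be
dropped. -/
theorem measure_trans_confidence_le {σ : ℝ≥0} {M : FactoredMDP G C σ} {π : ℕ → Ω → G.Policy}
    (hO : IsInteraction Pr M π O) (hτ : 0 < G.τ) {δ c : ℝ} (j : Fin m) [Nonempty (S j)]
    (z : ScopeSet X (G.ZP j))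
    (hc : c = 4 * m * (Fintype.card (ScopeSet X (G.ZP j)) : ℝ) / δ) (hc1 : 2 ≤ c) (N : ℕ) :
    Pr {ω | ∃ k, 2 * G.τ ≤ k ∧ k < N ∧ 0 < (O.visits k ω (G.ZP j) z).card ∧
      √(dTrans G δ k j / ((O.visits k ω (G.ZP j) z).card : ℝ)) <
        ∑ y, |M.P j z y - O.empTrans k ω j z y|} ≤ ENNReal.ofReal (4 / c ^ 2) := by
  have hτ' : (1 : ℝ) ≤ G.τ := by exact_mod_cast hτ
  have hcs : ∀ n', 2 ≤ c * visitScale G.τ n' := fun n' =>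
    hc1.trans (le_mul_of_one_le_right (by linarith) (hτ'.trans (le_visitScale _ _)))
  set K := Fintype.card (S j) with hK
  have hK1 : K ≠ 0 := Fintype.card_ne_zero
  let r : ℕ → ℝ := fun n' => √(4 * K * Real.log (c * visitScale G.τ n') / n')
  refine le_trans (measure_mono ?_) (measure_biUnion_visits_le (c := c) hτ (E := fun n' =>
    {ω | ∃ k ≤ N, (O.visits k ω (G.ZP j) z).card = n' ∧
        r n' ≤ ∑ y, |M.P j z y - O.empTrans k ω j z y|}) (fun n' hn' => ?_) (N * G.τ))
  · rintro ω ⟨k, hk, hkN, hpos, h⟩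
    simp only [Set.mem_iUnion, Finset.mem_Icc]
    have hle := O.card_visits_le k ω (G.ZP j) z
    refine ⟨_, ⟨hpos, hle.trans (Nat.mul_le_mul_right _ hkN.le)⟩, k, hkN.le, rfl, ?_⟩
    set n' := (O.visits k ω (G.ZP j) z).card with hn'
    have hn0 : (0 : ℝ) < n' := by exact_mod_cast hpos
    refine le_trans (Real.sqrt_le_sqrt ?_) h.le
    refine div_le_div_of_nonneg_right ?_ hn0.le
    have h2 : 4 * m * (Fintype.card (ScopeSet X (G.ZP j)) : ℝ) * ((k : ℝ) + 1) / δ =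
        c * (k + 1) := by
      rw [hc]
      ring
    rw [dTrans, h2]
    have h3 := hcs n'
    have h4 : c * visitScale G.τ n' ≤ c * (k + 1) :=
      mul_le_mul_of_nonneg_left (visitScale_le hτ hk hle) (by linarith)
    have := Real.log_le_log (by linarith) h4
    gcongr
  · refine (hO.measure_sum_abs_ge_le j z N hn' (Real.sqrt_nonneg _)).trans
      (ENNReal.ofReal_le_ofReal ?_)
    have hn0 : (0 : ℝ) < n' := by exact_mod_cast hn'
    have h2 := hcs n'
    set q := c * visitScale G.τ n' with hq
    have h0 : 0 < q := by linarith
    have h1 : (n' : ℝ) * r n' ^ 2 / 2 = K * (2 * Real.log q) := by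
      simp only [r]
      rw [Real.sq_sqrt (div_nonneg (mul_nonneg (by positivity) (Real.log_nonneg (by linarith)))
        hn0.le)]
      rw [← hq]
      field_simp
      ring
    have h3 : Real.exp (-(K * (2 * Real.log q))) = (1 / q ^ 2) ^ K := by
      rw [Real.exp_neg, Real.exp_nat_mul, ← Nat.cast_two (R := ℝ), Real.exp_nat_mul,
        Real.exp_log h0, one_div, inv_pow]
    rw [h1, h3, ← mul_pow, mul_one_div]
    refine pow_le_of_le_one (by positivity) ?_ hK1
    rw [div_le_one (by positivity)]
    nlinarith

end IsInteraction

end Confidence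

/-! ### From expected gaps to the observed path -/

section Gap

open scoped ENNReal

variable {m n l : ℕ} {S : Fin m → Type uS} {A : Type uA} {X : Fin n → Type uX}
variable {G : FactoredGraph S A X l} {Ω : Type uΩ}
variable [∀ j, Fintype (S j)] {C : ℝ} {σ : ℝ≥0}

/-- The conditional law of the state at step `v` of episode `k` given the preceding history. -/
noncomputable def FactoredMDP.arrivalLaw (M : FactoredMDP G C σ) (O : Observations G Ω) (k : ℕ)
    (v : Fin (G.τ + 1)) (ω : Ω) : (∀ j, S j) → ℝ :=
  Fin.cases (motive := fun _ => (∀ j, S j) → ℝ) M.ρ (fun u => M.trans (O.pair k u ω)) v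

/-- The difference between the conditional mean of a score of the state at step `v` of episode `k`
and the score of the observed state. -/
noncomputable def FactoredMDP.arrivalDiff (M : FactoredMDP G C σ) (O : Observations G Ω) (k : ℕ)
    (v : Fin (G.τ + 1)) (φ : (∀ j, S j) → ℝ) (ω : Ω) : ℝ :=
  ∑ s, M.arrivalLaw O k v ω s * φ s - φ (O.state k v ω)

theorem FactoredMDP.arrivalLaw_mem (M : FactoredMDP G C σ) (O : Observations G Ω) (k : ℕ)
    (v : Fin (G.τ + 1)) (ω : Ω) : M.arrivalLaw O k v ω ∈ stdSimplex ℝ (∀ j, S j) := by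
  induction v using Fin.cases with
  | zero => exact M.ρ_mem
  | succ u => exact M.trans_mem _

theorem Observations.measurable_arrivalLaw [∀ i, Finite (X i)] (O : Observations G Ω)
    (M : FactoredMDP G C σ) (k : ℕ) (v : Fin (G.τ + 1)) (s : ∀ j, S j) :
    Measurable[O.preHistory k v] fun ω => M.arrivalLaw O k v ω s := by
  induction v using Fin.cases with
  | zero => exact measurable_const
  | succ u => exact O.measurable_trans_pair M k u s

theorem Observations.measurable_apply_state {O : Observations G Ω} {F : MeasurableSpace Ω} {k : ℕ} {v : Fin (G.τ + 1)}
    (hs : Measurable[F, ⊤] (O.state k v)) {φ : Ω → (∀ j, S j) → ℝ}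
    (hφ : ∀ s, Measurable[F] fun ω => φ ω s) : Measurable[F] fun ω => φ ω (O.state k v ω) := by
  classical
  have h : (fun ω => φ ω (O.state k v ω)) =
      fun ω => ∑ s, ({ω | O.state k v ω = s} : Set Ω).indicator (fun ω => φ ω s) ω := by
    funext ω
    rw [Finset.sum_eq_single (O.state k v ω)]
    · rw [Set.indicator_of_mem]
      rfl
    · intro s _ hs
      rw [Set.indicator_of_notMem]
      exact fun h => hs h.symm
    · simp
  rw [h]
  exact Finset.measurable_fun_sum _ fun s _ =>
    (hφ s).indicator (hs (t := {s}) MeasurableSpace.measurableSet_top)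

variable [mΩ : MeasurableSpace Ω] {Pr : Measure Ω} {O : Observations G Ω}

theorem IsInteraction.arrivalLaw_law {M : FactoredMDP G C σ} {π : ℕ → Ω → G.Policy}
    (hO : IsInteraction Pr M π O) (k : ℕ) (v : Fin (G.τ + 1)) (s : ∀ j, S j) :
    Pr[Set.indicator {ω | O.state k v ω = s} (fun _ => (1 : ℝ)) | O.preHistory k v]
      =ᵐ[Pr] fun ω => M.arrivalLaw O k v ω s := by
  induction v using Fin.cases with
  | zero => exact hO.init_law k s
  | succ u => exact hO.next_law k u s

/-- An Azuma–Hoeffding inequality for predictable scores of the states. -/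
theorem IsInteraction.measure_sum_arrivalDiff_ge_le [IsProbabilityMeasure Pr]
    [∀ i, Finite (X i)] {M : FactoredMDP G C σ} {π : ℕ → Ω → G.Policy}
    (hO : IsInteraction Pr M π O) {φ : ℕ → Fin (G.τ + 1) → Ω → (∀ j, S j) → ℝ}
    (hφm : ∀ k v s, Measurable[O.episodeHistory k] fun ω => φ k v ω s) {b : ℝ}
    (hφ : ∀ k v ω s, φ k v ω s ∈ Set.Icc 0 b) (N : ℕ) (a : ℝ) {t : ℝ} (ht : 0 ≤ t) :
    Pr {ω | a ≤ ∑ k ∈ Finset.range N, ∑ v, M.arrivalDiff O k v (φ k v ω) ω} ≤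
      ENNReal.ofReal (Real.exp (-(t * a) + N * (G.τ + 1) * (t ^ 2 * b ^ 2 / 8))) := by
  let Y : ℕ → Fin (G.τ + 1) → Ω → ℝ≥0∞ := fun k v ω =>
    ENNReal.ofReal (Real.exp (t * M.arrivalDiff O k v (φ k v ω) ω - t ^ 2 * b ^ 2 / 8))
  have hY : ∀ k v (F : MeasurableSpace Ω), O.preHistory k v ≤ F →
      Measurable[F, ⊤] (O.state k v) → Measurable[F] (Y k v) := by
    intro k v F hF hs
    have hφF : ∀ s, Measurable[F] fun ω => φ k v ω s := fun s =>
      (hφm k v s).mono ((O.episodeHistory_le_preHistory k v).trans hF) le_rfl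
    refine ENNReal.measurable_ofReal.comp (Real.measurable_exp.comp
      (Measurable.sub_const (Measurable.const_mul (Measurable.sub ?_ ?_) t) _))
    · exact Finset.measurable_fun_sum _ fun s _ =>
        ((O.measurable_arrivalLaw M k v s).mono hF le_rfl).mul (hφF s)
    · exact Observations.measurable_apply_state hs hφF
  have hpre : ∀ k (v v' : Fin (G.τ + 1)), v < v' → O.preHistory k v ≤ O.preHistory k v' := by
    intro k v v' h
    induction v' using Fin.cases with
    | zero => exact absurd h (Fin.not_lt_zero _)
    | succ u' =>
      induction v using Fin.cases with
      | zero => exact O.episodeHistory_le_stepHistory k u'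
      | succ u => exact O.stepHistory_mono k (Fin.succ_lt_succ_iff.1 h)
  have hpre' : ∀ k k' (v : Fin (G.τ + 1)), k < k' → O.preHistory k v ≤ O.episodeHistory k' := by
    intro k k' v h
    induction v using Fin.cases with
    | zero => exact O.episodeHistory_mono h.le
    | succ u => exact O.stepHistory_le_episodeHistory h u
  have hprod := O.lintegral_prod_prod_le (Pr := Pr) (Y := Y) (fun k v => by
      have h := condMeanLEOne_exp_of_finite (hO.preHistory_le k v) (Y := O.state k v)
        (hO.measurableSet_state_eq k v) (p := M.arrivalLaw O k v) (φ := φ k v)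
        (O.measurable_arrivalLaw M k v) (M.arrivalLaw_mem O k v)
        (fun s => (hφm k v s).mono (O.episodeHistory_le_preHistory k v) le_rfl) (hφ k v)
        (hO.arrivalLaw_law k v) (-t)
      convert h using 5
      · simp only [FactoredMDP.arrivalDiff]
        ring
      · rw [neg_sq, sub_zero])
    (fun k v v' h => hY k v _ (hpre k v v' h) (O.measurable_state_preHistory k h))
    (fun k v k' h => hY k v _ (hpre' k k' v h) (O.measurable_state_episodeHistory h v)) N
  have heq : ∀ ω, ∏ k ∈ Finset.range N, ∏ v, Y k v ω = ENNReal.ofReal (Real.exp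
      (t * ∑ k ∈ Finset.range N, ∑ v, M.arrivalDiff O k v (φ k v ω) ω -
        N * (G.τ + 1) * (t ^ 2 * b ^ 2 / 8))) := by
    intro ω
    have h1 : t * ∑ k ∈ Finset.range N, ∑ v, M.arrivalDiff O k v (φ k v ω) ω -
        N * (G.τ + 1) * (t ^ 2 * b ^ 2 / 8) = ∑ k ∈ Finset.range N, ∑ v,
          (t * M.arrivalDiff O k v (φ k v ω) ω - t ^ 2 * b ^ 2 / 8) := by
      simp only [Finset.sum_sub_distrib, Finset.mul_sum, Finset.sum_const, Finset.card_univ,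
        Finset.card_range, Fintype.card_fin, nsmul_eq_mul]
      push_cast
      ring
    rw [h1, Real.exp_sum, ENNReal.ofReal_prod_of_nonneg fun _ _ => (Real.exp_pos _).le]
    refine Finset.prod_congr rfl fun k _ => ?_
    rw [Real.exp_sum, ENNReal.ofReal_prod_of_nonneg fun _ _ => (Real.exp_pos _).le]
  set B : ℝ := N * (G.τ + 1) * (t ^ 2 * b ^ 2 / 8) with hB
  have hmeas : Measurable fun ω => ∏ k ∈ Finset.range N, ∏ v, Y k v ω :=
    Finset.measurable_fun_prod _ fun k _ => Finset.measurable_fun_prod _ fun v _ =>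
      hY k v mΩ (hO.preHistory_le k v) (hO.state_meas k v)
  have hsub : {ω | a ≤ ∑ k ∈ Finset.range N, ∑ v, M.arrivalDiff O k v (φ k v ω) ω} ⊆
      {ω | ENNReal.ofReal (Real.exp (t * a - B)) ≤ ∏ k ∈ Finset.range N, ∏ v, Y k v ω} := by
    intro ω hω
    rw [Set.mem_ofPred_eq] at hω
    rw [Set.mem_ofPred_eq, heq]
    exact ENNReal.ofReal_le_ofReal (Real.exp_le_exp.2
      (sub_le_sub_right (mul_le_mul_of_nonneg_left hω ht) _))
  have hpos : ENNReal.ofReal (Real.exp (t * a - B)) ≠ 0 := by simp [Real.exp_pos]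
  calc _ ≤ _ := measure_mono hsub
    _ ≤ (∫⁻ ω, ∏ k ∈ Finset.range N, ∏ v, Y k v ω ∂Pr) / ENNReal.ofReal (Real.exp (t * a - B)) :=
      meas_ge_le_lintegral_div hmeas.aemeasurable hpos ENNReal.ofReal_ne_top
    _ ≤ 1 / ENNReal.ofReal (Real.exp (t * a - B)) := by gcongr
    _ = ENNReal.ofReal (Real.exp (-(t * a) + B)) := by
      rw [one_div, ← ENNReal.ofReal_inv_of_pos (Real.exp_pos _), ← Real.exp_neg]
      congr 2
      ring

/-- The bound on the one-step error at `x` in episode `k`, where `b` bounds the error of a factor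
in terms of the number of visits. -/
noncomputable def Observations.stepWidth (O : Observations G Ω) (b : ℕ → ℝ) (k : ℕ) (ω : Ω) (x : ∀ i, X i) : ℝ :=
  ∑ i, b (O.visits k ω (G.ZR i) ((G.ZR i).restrict x)).card +
    ((G.τ : ℝ) - 1) * ∑ j, b (O.visits k ω (G.ZP j) ((G.ZP j).restrict x)).card

/-- As `ρ` sums to one, there is a state; fixing it embeds the actions into the finite product of
the `X i`. -/
theorem FactoredMDP.finite_policy [∀ i, Finite (X i)] (M : FactoredMDP G C σ) :
    Finite G.Policy := by
  have hne : Nonempty (∀ j, S j) := by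
    by_contra h
    rw [not_nonempty_iff] at h
    have := M.ρ_mem.2
    simp at this
  obtain ⟨s⟩ := hne
  have : Finite A := Finite.of_injective (fun a => G.split (s, a)) fun a a' h =>
    (Prod.ext_iff.1 (G.split.injective h)).2
  infer_instance

/-- The gap depends on the data only through the policy and the earlier state-action pairs, which
take finitely many values. This predictability is the reason for using it in place of the value
function of the optimistic MDP. -/
theorem IsInteraction.measurable_clippedGap [∀ i, Finite (X i)] {M : FactoredMDP G C σ}
    {π : ℕ → Ω → G.Policy} (hO : IsInteraction Pr M π O) (hτ : 0 < G.τ) (b : ℕ → ℝ) (k d : ℕ)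
    (s : ∀ j, S j) : Measurable[O.episodeHistory k] fun ω =>
      M.clippedGap hτ (π k ω) (O.stepWidth b k ω) d s := by
  have := M.finite_policy
  refine O.measurable_of_pairs (Finset.range k ×ˢ Finset.univ)
    (fun q hq x => O.measurableSet_pair_episodeHistory
      (Finset.mem_range.1 (Finset.mem_product.1 hq).1) _ x) (π k)
    (fun μ => hO.policy_meas k (MeasurableSpace.measurableSet_top)) (fun ω ω' h hπ => ?_)
  have hw : O.stepWidth b k ω = O.stepWidth b k ω' := by
    funext x
    have hv : ∀ (Z : Finset (Fin n)) (z : ScopeSet X Z), O.visits k ω Z z = O.visits k ω' Z z :=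
      fun Z z => O.visits_congr fun k' hk' u => h (k', u) (by simpa using hk')
    simp only [Observations.stepWidth, hv]
  rw [hw, hπ]

/-- Follow the gap along the observed states: each step loses at most the width at the observed pair
plus a martingale difference, and no gap is left after the last step. The difference with index 0
accounts for the draw of the initial state. -/
theorem IsInteraction.sum_mul_clippedGap_le {M : FactoredMDP G C σ}
    {π : ℕ → Ω → G.Policy} (hO : IsInteraction Pr M π O) (hτ : 0 < G.τ) (w : (∀ i, X i) → ℝ)
    (k : ℕ) (ω : Ω) :
    ∑ s, M.ρ s * M.clippedGap hτ (π k ω) w G.τ s ≤ ∑ u, w (O.pair k u ω) +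
      ∑ v : Fin (G.τ + 1), M.arrivalDiff O k v (M.clippedGap hτ (π k ω) w (G.τ - v)) ω := by
  let f : Fin (G.τ + 1) → ℝ := fun v => M.clippedGap hτ (π k ω) w (G.τ - v) (O.state k v ω)
  have h1 : ∀ u : Fin G.τ, f u.castSucc - f u.succ ≤ w (O.pair k u ω) +
      M.arrivalDiff O k u.succ (M.clippedGap hτ (π k ω) w (G.τ - u.succ)) ω := by
    intro u
    have hd : G.τ - u.castSucc = (G.τ - u.succ) + 1 := by
      simp only [Fin.val_castSucc, Fin.val_succ]
      omega
    have hpair : G.pairToGo hτ (π k ω) (G.τ - u.succ) (O.state k u.castSucc ω) =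
        O.pair k u ω := by
      rw [Observations.pair, hO.action_eq, FactoredGraph.pairToGo]
      congr 3
      ext
      simp only [Fin.val_succ]
      omega
    have h2 := M.clippedGap_succ_le hτ (π k ω) w (G.τ - u.succ) (O.state k u.castSucc ω)
    rw [hpair] at h2
    simp only [f, FactoredMDP.arrivalDiff]
    rw [hd]
    have h3 : M.arrivalLaw O k u.succ ω = M.trans (O.pair k u ω) := rfl
    rw [h3]
    linarith
  have h2 : f 0 = ∑ u : Fin G.τ, (f u.castSucc - f u.succ) := by
    have h3 := Fin.sum_univ_castSucc f
    rw [Fin.sum_univ_succ] at h3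
    have h4 : f (Fin.last G.τ) = 0 := by simp [f, FactoredMDP.clippedGap]
    rw [Finset.sum_sub_distrib]
    linarith
  have h3 := Finset.sum_le_sum fun u (_ : u ∈ Finset.univ) => h1 u
  rw [← h2, Finset.sum_add_distrib] at h3
  rw [Fin.sum_univ_succ]
  have h4 : M.arrivalDiff O k 0 (M.clippedGap hτ (π k ω) w (G.τ - (0 : Fin (G.τ + 1)))) ω =
      ∑ s, M.ρ s * M.clippedGap hτ (π k ω) w G.τ s - f 0 := rfl
  rw [h4]
  linarith

end Gap

/-! ### Summing the widths along the path -/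

section Pigeonhole

variable {m n l : ℕ} {S : Fin m → Type uS} {A : Type uA} {X : Fin n → Type uX}
variable {G : FactoredGraph S A X l} {Ω : Type uΩ}

/-- The bound on the error of a factor after `n` visits. -/
noncomputable def factorWidth (τ : ℕ) (β : ℝ) (n : ℕ) : ℝ :=
  if n < τ then 2 else 2 * √(β / n)

theorem factorWidth_nonneg (τ : ℕ) (β : ℝ) (n : ℕ) : 0 ≤ factorWidth τ β n := by
  rw [factorWidth]
  split_ifs <;> positivity

/-- Counts are updated only between episodes, so all `v` visits during an episode pay the same
width. If `n < τ`, then `n + v < 2τ` and `2v` is the growth of `2 min(·, 2τ)`. Otherwise `v ≤ n`, so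
`p = √n` and `q = √(n + v)` satisfy `q ≤ 3p/2`, whence `2v/p = 2(q - p)(q + p)/p ≤ 5(q - p)`. -/
theorem mul_factorWidth_le {τ v n : ℕ} {β : ℝ} (hβ : 0 ≤ β) (hv : v ≤ τ) :
    v * factorWidth τ β n ≤ (2 * (min (n + v) (2 * τ) : ℕ) + 5 * √β * √((n + v : ℕ) : ℝ)) -
      (2 * (min n (2 * τ) : ℕ) + 5 * √β * √(n : ℝ)) := by
  have hmono : √(n : ℝ) ≤ √((n + v : ℕ) : ℝ) := Real.sqrt_le_sqrt (by push_cast; simp)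
  have h5 : 0 ≤ 5 * √β := by positivity
  rw [factorWidth]
  split_ifs with h
  · rw [min_eq_left (by omega), min_eq_left (by omega)]
    have := mul_le_mul_of_nonneg_left hmono h5
    push_cast at this ⊢
    linarith
  · have hmin : ((min n (2 * τ) : ℕ) : ℝ) ≤ (min (n + v) (2 * τ) : ℕ) := by
      exact_mod_cast min_le_min_right _ (by omega)
    rcases Nat.eq_zero_or_pos n with rfl | hn
    · obtain rfl : v = 0 := by omega
      simp
    have hn0 : (0 : ℝ) < n := by exact_mod_cast hn
    have hvn : (v : ℝ) ≤ n := by exact_mod_cast hv.trans (not_lt.1 h)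
    set p := √(n : ℝ) with hp
    set q := √((n + v : ℕ) : ℝ) with hq
    have hp0 : 0 < p := Real.sqrt_pos.2 hn0
    have hp2 : p ^ 2 = n := Real.sq_sqrt hn0.le
    have hq2 : q ^ 2 = n + v := by
      rw [hq, Real.sq_sqrt (by positivity)]
      push_cast
      rfl
    have hq0 : 0 ≤ q := Real.sqrt_nonneg _
    have hqp : 2 * q ≤ 3 * p := by nlinarith
    have hkey : 2 * (v : ℝ) / p ≤ 5 * (q - p) := by
      rw [div_le_iff₀ hp0]
      nlinarith [mul_nonneg (sub_nonneg.2 hmono) (sub_nonneg.2 hqp)]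
    rw [Real.sqrt_div hβ, ← hp]
    have := mul_le_mul_of_nonneg_left hkey (Real.sqrt_nonneg β)
    calc (v : ℝ) * (2 * (√β / p)) = √β * (2 * v / p) := by ring
      _ ≤ _ := by linarith

namespace Observations

variable (O : Observations G Ω)

open scoped Classical in
theorem card_visits_succ (k : ℕ) (ω : Ω) (Z : Finset (Fin n)) (z : ScopeSet X Z) :
    (O.visits (k + 1) ω Z z).card = (O.visits k ω Z z).card +
      (Finset.univ.filter fun u => Z.restrict (O.pair k u ω) = z).card := by
  have h : O.visits (k + 1) ω Z z = O.visits k ω Z z ∪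
      (Finset.univ.filter fun u => Z.restrict (O.pair k u ω) = z).image fun u => (k, u) := by
    ext ⟨k', u⟩
    simp only [mem_visits, Finset.mem_union, Finset.mem_image, Finset.mem_filter,
      Finset.mem_univ, true_and, Prod.mk.injEq]
    constructor
    · rintro ⟨h1, h2⟩
      rcases Nat.lt_succ_iff_lt_or_eq.1 h1 with h | rfl
      · exact Or.inl ⟨h, h2⟩
      · exact Or.inr ⟨u, h2, rfl, rfl⟩
    · rintro (h | ⟨u', h1, rfl, rfl⟩)
      · exact ⟨by omega, h.2⟩
      · exact ⟨by omega, h1⟩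
  rw [h, Finset.card_union_of_disjoint, Finset.card_image_of_injective]
  · exact fun a b h => (Prod.ext_iff.1 h).2
  · rw [Finset.disjoint_left]
    intro p hp hp'
    rw [mem_visits] at hp
    obtain ⟨u, _, rfl⟩ := Finset.mem_image.1 hp'
    exact lt_irrefl _ hp.1

variable [∀ i, Fintype (X i)]

theorem sum_card_visits (k : ℕ) (ω : Ω) (Z : Finset (Fin n)) :
    ∑ z, (O.visits k ω Z z).card = k * G.τ := by
  classical
  have := Finset.card_eq_sum_card_fiberwise (s := Finset.range k ×ˢ (Finset.univ : Finset (Fin G.τ)))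
    (t := Finset.univ) (f := fun p => Z.restrict (O.pair p.1 p.2 ω)) (fun _ _ => by simp)
  rw [Finset.card_product, Finset.card_range, Finset.card_univ, Fintype.card_fin] at this
  rw [this]
  refine Finset.sum_congr rfl fun z _ => ?_
  congr 1

/-- The right-hand side is a potential: its increase in an episode pays, for each `z` separately,
for the widths met in that episode. -/
theorem sum_factorWidth_le_sum {β : ℝ} (hβ : 0 ≤ β) (N : ℕ) (ω : Ω) (Z : Finset (Fin n)) :
    ∑ k ∈ Finset.range N, ∑ u,
      factorWidth G.τ β (O.visits k ω Z (Z.restrict (O.pair k u ω))).card ≤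
    ∑ z, (2 * (min (O.visits N ω Z z).card (2 * G.τ) : ℕ) +
      5 * √β * √((O.visits N ω Z z).card : ℝ)) := by
  classical
  induction N with
  | zero =>
    simp only [Finset.range_zero, Finset.sum_empty]
    exact Finset.sum_nonneg fun z _ => by positivity
  | succ N ih =>
    rw [Finset.sum_range_succ, ← le_sub_iff_add_le']
    refine le_trans ?_ (sub_le_sub_left ih _)
    rw [← Finset.sum_sub_distrib,
      ← Finset.sum_fiberwise Finset.univ (fun u => Z.restrict (O.pair N u ω))]
    refine Finset.sum_le_sum fun z _ => ?_
    have h1 : ∑ u with Z.restrict (O.pair N u ω) = z,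
        factorWidth G.τ β (O.visits N ω Z (Z.restrict (O.pair N u ω))).card =
        ((Finset.univ.filter fun u => Z.restrict (O.pair N u ω) = z).card : ℝ) *
          factorWidth G.τ β (O.visits N ω Z z).card := by
      rw [← nsmul_eq_mul, ← Finset.sum_const]
      refine Finset.sum_congr rfl fun u hu => ?_
      rw [(Finset.mem_filter.1 hu).2]
    rw [h1, card_visits_succ]
    refine mul_factorWidth_le hβ ((Finset.card_filter_le _ _).trans ?_)
    simp

/-- Cauchy–Schwarz over `z`, as the counts add up to `N τ`. -/
theorem sum_factorWidth_le {β : ℝ} (hβ : 0 ≤ β) (N : ℕ) (ω : Ω) (Z : Finset (Fin n)) :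
    ∑ k ∈ Finset.range N, ∑ u,
      factorWidth G.τ β (O.visits k ω Z (Z.restrict (O.pair k u ω))).card ≤
    4 * G.τ * Fintype.card (ScopeSet X Z) +
      5 * √β * √((Fintype.card (ScopeSet X Z) : ℝ) * (N * G.τ)) := by
  refine (O.sum_factorWidth_le_sum hβ N ω Z).trans ?_
  rw [Finset.sum_add_distrib, ← Finset.mul_sum, ← Finset.mul_sum]
  refine add_le_add ?_ (mul_le_mul_of_nonneg_left ?_ (by positivity))
  · have : ∑ z : ScopeSet X Z, ((min (O.visits N ω Z z).card (2 * G.τ) : ℕ) : ℝ) ≤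
        ∑ _z : ScopeSet X Z, (2 * G.τ : ℝ) :=
      Finset.sum_le_sum fun z _ => by exact_mod_cast min_le_right _ _
    rw [Finset.sum_const, Finset.card_univ, nsmul_eq_mul] at this
    linarith
  · have h1 := Real.sum_sqrt_mul_sqrt_le (Finset.univ : Finset (ScopeSet X Z)) (f := fun _ => 1)
      (g := fun z => ((O.visits N ω Z z).card : ℝ)) (fun _ => zero_le_one)
      (fun _ => Nat.cast_nonneg _)
    have h2 : ∑ z, ((O.visits N ω Z z).card : ℝ) = N * G.τ := by
      exact_mod_cast O.sum_card_visits N ω Z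
    rw [h2] at h1
    simp only [Real.sqrt_one, one_mul, Finset.sum_const, Finset.card_univ, nsmul_eq_mul,
      mul_one] at h1
    rwa [← Real.sqrt_mul (Nat.cast_nonneg _)] at h1

end Observations

theorem sum_sqrt_div_le (τ N : ℕ) :
    ∑ k ∈ Finset.range N, √((τ : ℝ) / ((k : ℝ) + 1)) ≤ 2 * √((N : ℝ) * τ) := by
  have h : ∑ k ∈ Finset.range N, 1 / √((k : ℝ) + 1) ≤ 2 * √(N : ℝ) := by
    induction N with
    | zero => simp
    | succ N ih =>
      rw [Finset.sum_range_succ]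
      push_cast
      set p := √(N : ℝ)
      set q := √((N : ℝ) + 1)
      have hp : 0 ≤ p := Real.sqrt_nonneg _
      have hq : 0 < q := Real.sqrt_pos.2 (by positivity)
      have hp2 : p ^ 2 = N := Real.sq_sqrt (by positivity)
      have hq2 : q ^ 2 = N + 1 := Real.sq_sqrt (by positivity)
      have : 1 / q ≤ 2 * q - 2 * p := by
        rw [div_le_iff₀ hq]
        nlinarith [sq_nonneg (q - p)]
      linarith
  have h2 : ∀ k : ℕ, √((τ : ℝ) / ((k : ℝ) + 1)) = √(τ : ℝ) * (1 / √((k : ℝ) + 1)) := by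
    intro k
    rw [Real.sqrt_div (Nat.cast_nonneg _)]
    ring
  simp only [h2]
  rw [← Finset.mul_sum, Real.sqrt_mul (Nat.cast_nonneg _)]
  have := mul_le_mul_of_nonneg_left h (Real.sqrt_nonneg (τ : ℝ))
  linarith

end Pigeonhole

/-! ### Optimism and the decomposition of the regret -/

section Regret

variable {m n l : ℕ} {S : Fin m → Type uS} {A : Type uA} {X : Fin n → Type uX}
variable {G : FactoredGraph S A X l} {Ω : Type uΩ}
theorem Observations.sum_stepWidth_le [∀ i, Fintype (X i)] {J : ℕ}
    (hZR : ∀ i, Fintype.card (ScopeSet X (G.ZR i)) = J)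
    (hZP : ∀ j, Fintype.card (ScopeSet X (G.ZP j)) = J) (hτ : 0 < G.τ) {β : ℝ} (hβ : 0 ≤ β)
    (O : Observations G Ω) (N : ℕ) (ω : Ω) :
    ∑ k ∈ Finset.range N, ∑ u, O.stepWidth (factorWidth G.τ β) k ω (O.pair k u ω) ≤
      (l + (G.τ - 1) * m) * (4 * G.τ * J + 5 * √β * √((J : ℝ) * (N * G.τ))) := by
  have hτ' : (1 : ℝ) ≤ G.τ := by exact_mod_cast hτ
  have h1 : ∑ k ∈ Finset.range N, ∑ u, O.stepWidth (factorWidth G.τ β) k ω (O.pair k u ω) =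
      ∑ i, ∑ k ∈ Finset.range N, ∑ u, factorWidth G.τ β
          (O.visits k ω (G.ZR i) ((G.ZR i).restrict (O.pair k u ω))).card +
        (G.τ - 1) * ∑ j, ∑ k ∈ Finset.range N, ∑ u, factorWidth G.τ β
          (O.visits k ω (G.ZP j) ((G.ZP j).restrict (O.pair k u ω))).card := by
    simp only [Observations.stepWidth, Finset.sum_add_distrib, ← Finset.mul_sum]
    congr 1
    · rw [Finset.sum_comm (s := Finset.univ) (t := Finset.range N)]
      exact Finset.sum_congr rfl fun k _ => Finset.sum_comm
    · congr 1
      rw [Finset.sum_comm (s := Finset.univ) (t := Finset.range N)]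
      exact Finset.sum_congr rfl fun k _ => Finset.sum_comm
  have h2 : ∀ i, ∑ k ∈ Finset.range N, ∑ u, factorWidth G.τ β
      (O.visits k ω (G.ZR i) ((G.ZR i).restrict (O.pair k u ω))).card ≤
      4 * G.τ * J + 5 * √β * √((J : ℝ) * (N * G.τ)) := fun i => by
    have := O.sum_factorWidth_le hβ N ω (G.ZR i)
    rwa [hZR i] at this
  have h3 : ∀ j, ∑ k ∈ Finset.range N, ∑ u, factorWidth G.τ β
      (O.visits k ω (G.ZP j) ((G.ZP j).restrict (O.pair k u ω))).card ≤
      4 * G.τ * J + 5 * √β * √((J : ℝ) * (N * G.τ)) := fun j => by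
    have := O.sum_factorWidth_le hβ N ω (G.ZP j)
    rwa [hZP j] at this
  have h4 := Finset.sum_le_sum fun i (_ : i ∈ Finset.univ) => h2 i
  have h5 := Finset.sum_le_sum fun j (_ : j ∈ Finset.univ) => h3 j
  rw [Finset.sum_const, Finset.card_univ, Fintype.card_fin, nsmul_eq_mul] at h4 h5
  rw [h1]
  have h6 := mul_le_mul_of_nonneg_left h5 (sub_nonneg.2 hτ')
  linarith

variable [∀ j, Fintype (S j)]

theorem FactoredMDP.episodeValue_mem {C : ℝ} {σ : ℝ≥0} (M : FactoredMDP G C σ) (hτ : 0 < G.τ)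
    (μ : G.Policy) : M.episodeValue μ ∈ Set.Icc 0 (C * G.τ) := by
  rw [M.episodeValue_eq hτ]
  have h := M.valueToGo_mem hτ μ G.τ
  refine ⟨Finset.sum_nonneg fun s _ => mul_nonneg (M.ρ_mem.1 s) (h s).1, ?_⟩
  calc _ ≤ ∑ s, M.ρ s * (C * G.τ) :=
        Finset.sum_le_sum fun s _ => mul_le_mul_of_nonneg_left (h s).2 (M.ρ_mem.1 s)
    _ = C * G.τ := by rw [← Finset.sum_mul, M.ρ_mem.2, one_mul]

theorem sum_abs_sub_le_two {V : Type*} [Fintype V] {p q : V → ℝ} (hp : p ∈ stdSimplex ℝ V)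
    (hq : q ∈ stdSimplex ℝ V) : ∑ v, |p v - q v| ≤ 2 := by
  calc _ ≤ ∑ v, (p v + q v) := Finset.sum_le_sum fun v _ => by
        rw [abs_le]
        constructor <;> linarith [hp.1 v, hq.1 v]
    _ = 2 := by
      rw [Finset.sum_add_distrib, hp.2, hq.2]
      norm_num

variable [∀ i, Fintype (X i)] {O : Observations G Ω}

/-- The value of a policy is almost the same in all the MDPs in a confidence set. -/
theorem episodeValue_sub_le_of_mem_confidenceSet {δ : ℝ} {ρ : (∀ j, S j) → ℝ} {k : ℕ} {ω : Ω}
    {M M' : FactoredMDP G 1 1} (hτ : 0 < G.τ) (hM : M ∈ confidenceSet 1 1 δ ρ O k ω)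
    (hM' : M' ∈ confidenceSet 1 1 δ ρ O k ω) {β : ℝ} (hR : ∀ i, dReward G 1 δ k i ≤ β)
    (hP : ∀ j, dTrans G δ k j ≤ β) (μ : G.Policy) :
    M'.episodeValue μ - M.episodeValue μ ≤ ∑ s, M.ρ s *
      M.clippedGap hτ μ (O.stepWidth (factorWidth G.τ β) k ω) G.τ s := by
  have hτ' : (1 : ℝ) ≤ G.τ := by exact_mod_cast hτ
  rw [M.episodeValue_eq hτ, M'.episodeValue_eq hτ, hM'.1, hM.1, ← Finset.sum_sub_distrib]
  refine Finset.sum_le_sum fun s _ => ?_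
  rw [← mul_sub]
  refine mul_le_mul_of_nonneg_left ?_ (by rw [← hM.1]; exact M.ρ_mem.1 s)
  refine M.valueToGo_sub_le_clippedGap M' zero_le_one hτ μ (fun x => ?_) G.τ le_rfl s
  rw [one_mul]
  -- Below `τ` visits the trivial bound 2 is used. From `τ ≥ 1` visits on the count is positive, so
  -- the confidence bounds of both MDPs apply and the triangle inequality gives twice the radius.
  have hdist : ∀ {n' : ℕ} {d D : ℝ}, d ≤ β → D ≤ 2 →
      (0 < n' → D ≤ √(d / n') + √(d / n')) → D ≤ factorWidth G.τ β n' := by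
    intro n' d D hd hD h
    rw [factorWidth]
    split_ifs with hn'
    · exact hD
    · have h1 : √(d / n') ≤ √(β / n') :=
        Real.sqrt_le_sqrt (div_le_div_of_nonneg_right hd (Nat.cast_nonneg _))
      linarith [h (by omega)]
  refine M.meanReward_sub_add_le M' (by linarith) (fun i => ?_) (fun j => ?_)
  · refine hdist (hR i) ?_ fun hn' => ?_
    · linarith [((M'.R_law i ((G.ZR i).restrict x)).mean_mem).2,
        ((M.R_law i ((G.ZR i).restrict x)).mean_mem).1]
    · linarith [(abs_le.1 (hM.2.1 i _ hn')).1, (abs_le.1 (hM'.2.1 i _ hn')).2]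
  · refine hdist (hP j) (sum_abs_sub_le_two (M'.P_mem j _) (M.P_mem j _)) fun hn' => ?_
    refine le_trans ?_ (add_le_add (hM'.2.2 j _ hn') (hM.2.2 j _ hn'))
    rw [← Finset.sum_add_distrib]
    refine Finset.sum_le_sum fun y _ => ?_
    rw [abs_sub_comm (M.P j _ y)]
    exact abs_sub_le _ _ _

/-- Optimism: `M` competes in the planner's maximum, so `μ` in `M` is worth at most the chosen
policy in `M'` plus the planning error. What remains compares the same policy in `M'` and `M`. -/
theorem episodeValue_sub_ucrlFactored_le {δ : ℝ} {k : ℕ} {ω : Ω}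
    {M : FactoredMDP G 1 1} {Γ : Set (FactoredMDP G 1 1) → ℝ → G.Policy}
    (hΓ : IsOptimisticPlanner Γ) (hτ : 0 < G.τ) (hM : M ∈ confidenceSet 1 1 δ M.ρ O k ω)
    {β : ℝ} (hR : ∀ i, dReward G 1 δ k i ≤ β) (hP : ∀ j, dTrans G δ k j ≤ β) (μ : G.Policy) :
    M.episodeValue μ - M.episodeValue (ucrlFactored Γ δ M.ρ O k ω) ≤
      √((G.τ : ℝ) / ((k : ℝ) + 1)) + ∑ s, M.ρ s *
        M.clippedGap hτ (ucrlFactored Γ δ M.ρ O k ω) (O.stepWidth (factorWidth G.τ β) k ω) G.τ s := by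
  have hτ' : (0 : ℝ) < G.τ := by exact_mod_cast hτ
  obtain ⟨M', hM', h⟩ := hΓ _ (√((G.τ : ℝ) / ((k : ℝ) + 1))) ⟨M, hM⟩
    (Real.sqrt_pos.2 (by positivity))
  have h1 := h M hM μ
  have h2 := episodeValue_sub_le_of_mem_confidenceSet hτ hM hM' hR hP
    (ucrlFactored Γ δ M.ρ O k ω)
  simp only [ucrlFactored] at h1 h2 ⊢
  linarith

/-- The first `2τ` episodes, where membership in the confidence set is not assumed, cost at most `τ`
each; their gaps, being nonnegative, may still be added, so that the martingale runs over all `N`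
episodes. -/
theorem sum_episodeValue_sub_le {δ : ℝ} {ω : Ω} [MeasurableSpace Ω]
    {Pr : Measure Ω} {M : FactoredMDP G 1 1} {Γ : Set (FactoredMDP G 1 1) → ℝ → G.Policy}
    (hO : IsInteraction Pr M (ucrlFactored Γ δ M.ρ O) O)
    (hΓ : IsOptimisticPlanner Γ) (hτ : 0 < G.τ) {N : ℕ}
    (hM : ∀ k, 2 * G.τ ≤ k → k < N → M ∈ confidenceSet 1 1 δ M.ρ O k ω)
    {β : ℝ} (hR : ∀ k < N, ∀ i, dReward G 1 δ k i ≤ β) (hP : ∀ k < N, ∀ j, dTrans G δ k j ≤ β)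
    (μ : G.Policy) :
    ∑ k ∈ Finset.range N, (M.episodeValue μ - M.episodeValue (ucrlFactored Γ δ M.ρ O k ω)) ≤
      2 * √((N : ℝ) * G.τ) + 2 * (G.τ : ℝ) ^ 2 +
      ∑ k ∈ Finset.range N, ∑ u, O.stepWidth (factorWidth G.τ β) k ω (O.pair k u ω) +
      ∑ k ∈ Finset.range N, ∑ v : Fin (G.τ + 1), M.arrivalDiff O k v
        (M.clippedGap hτ (ucrlFactored Γ δ M.ρ O k ω) (O.stepWidth (factorWidth G.τ β) k ω)
          (G.τ - v)) ω := by
  have hτ' : (1 : ℝ) ≤ G.τ := by exact_mod_cast hτ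
  have hw : ∀ k x, 0 ≤ O.stepWidth (factorWidth G.τ β) k ω x := fun k x =>
    add_nonneg (Finset.sum_nonneg fun i _ => factorWidth_nonneg _ _ _)
      (mul_nonneg (by linarith) (Finset.sum_nonneg fun i _ => factorWidth_nonneg _ _ _))
  have h1 : ∀ k ∈ Finset.range N,
      M.episodeValue μ - M.episodeValue (ucrlFactored Γ δ M.ρ O k ω) ≤
      √((G.τ : ℝ) / ((k : ℝ) + 1)) + (if k < 2 * G.τ then (G.τ : ℝ) else 0) +
      ∑ s, M.ρ s * M.clippedGap hτ (ucrlFactored Γ δ M.ρ O k ω)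
        (O.stepWidth (factorWidth G.τ β) k ω) G.τ s := by
    intro k hk
    rw [Finset.mem_range] at hk
    split_ifs with h
    · have h2 := (M.episodeValue_mem hτ μ).2
      have h3 := (M.episodeValue_mem hτ (ucrlFactored Γ δ M.ρ O k ω)).1
      have h4 : 0 ≤ ∑ s, M.ρ s * M.clippedGap hτ (ucrlFactored Γ δ M.ρ O k ω)
          (O.stepWidth (factorWidth G.τ β) k ω) G.τ s := Finset.sum_nonneg fun s _ =>
        mul_nonneg (M.ρ_mem.1 s) (M.clippedGap_mem zero_le_one hτ _ (hw k) _ s).1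
      have h5 := Real.sqrt_nonneg ((G.τ : ℝ) / ((k : ℝ) + 1))
      linarith
    · rw [add_zero]
      exact episodeValue_sub_ucrlFactored_le hΓ hτ (hM k (not_lt.1 h) hk) (hR k hk) (hP k hk) μ
  have h2 : ∑ k ∈ Finset.range N, (if k < 2 * G.τ then (G.τ : ℝ) else 0) ≤ 2 * (G.τ : ℝ) ^ 2 := by
    rw [← Finset.sum_filter, Finset.sum_const, nsmul_eq_mul]
    have h3 : ((Finset.range N).filter fun k => k < 2 * G.τ).card ≤ 2 * G.τ := by
      calc _ ≤ (Finset.range (2 * G.τ)).card := Finset.card_le_card fun k hk => by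
            rw [Finset.mem_range]
            exact (Finset.mem_filter.1 hk).2
        _ = _ := Finset.card_range _
    have h4 : ((((Finset.range N).filter fun k => k < 2 * G.τ).card : ℕ) : ℝ) ≤ 2 * G.τ := by
      exact_mod_cast h3
    nlinarith
  have h3 := Finset.sum_le_sum h1
  have h4 := Finset.sum_le_sum fun k (_ : k ∈ Finset.range N) =>
    hO.sum_mul_clippedGap_le hτ (O.stepWidth (factorWidth G.τ β) k ω) k ω
  rw [Finset.sum_add_distrib, Finset.sum_add_distrib] at h3
  rw [Finset.sum_add_distrib] at h4
  linarith [sum_sqrt_div_le G.τ N]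

end Regret

/-! ### Constants and the final union bound -/

/-- The comparison of the explicit regret bound with its simplified form, outside the range where
the latter is trivial. -/
theorem regret_bound_le {τ m l J K L T N : ℝ} (hτ : 1 ≤ τ) (hl : l + 1 = m) (hm : 1 ≤ m)
    (hJ : 1 ≤ J) (hK : 1 ≤ K) (hL : 2 ≤ L) (hT : 1 ≤ T) (hN0 : 0 ≤ N) (hN : N * τ ≤ T + τ)
    (hlarge : 15 * m * τ * √(J * K * T * L) < N * τ) :
    2 * √(N * τ) + 2 * τ ^ 2 +
      (l + (τ - 1) * m) * (4 * τ * J + 5 * √(4 * K * L) * √(J * (N * τ))) + τ * √(N * τ * L) ≤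
    15 * m * τ * √(J * K * T * L) := by
  set q := √(J * K * T * L) with hq
  set P := J * K * L with hP
  have hJK : 1 ≤ J * K := one_le_mul_of_one_le_of_one_le hJ hK
  have hP2 : 2 ≤ P := by nlinarith
  have hJP : 2 * J ≤ P := by
    have : 2 ≤ K * L := by nlinarith
    nlinarith
  have hLP : L ≤ P := by nlinarith
  have hq0 : 0 ≤ q := Real.sqrt_nonneg _
  have hq2 : q ^ 2 = P * T := by
    rw [hq, Real.sq_sqrt (by positivity), hP]
    ring
  have hmτ : 1 ≤ m * τ := one_le_mul_of_one_le_of_one_le hm hτ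
  have hq1 : 1 ≤ q := by nlinarith
  have hlarge' : 15 * (m * τ) * q < T + τ := by linarith
  have hmτ' : τ ≤ m * τ := le_mul_of_one_le_left (by linarith) hm
  have h15 : 15 * τ * q ≤ 15 * (m * τ) * q := by gcongr 15 * ?_ * q
  have hτT : τ ≤ T := by nlinarith
  have h1 : 15 * (m * τ) * q < 2 * T := by linarith
  -- Since `q² = P T`, the lower bound on `T` becomes a lower bound on `q`, against which the
  -- lower-order terms are small.
  have h2 : 15 * (m * τ) * P ≤ 2 * q := by
    by_contra! h
    have h3 : 2 * q * q < 15 * (m * τ) * P * q := by gcongr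
    nlinarith
  have h3 : 100 * τ ≤ T := by
    have h4 : 15 * τ ≤ q := by nlinarith
    nlinarith
  have hNT : N * τ ≤ 1.01 * T := by linarith
  have hNτ : 0 ≤ N * τ := by positivity
  have hq' : √(P * (N * τ)) ≤ 1.01 * q := by
    refine Real.sqrt_le_iff.2 ⟨by positivity, ?_⟩
    have : P * (N * τ) ≤ P * (1.01 * T) := by gcongr
    nlinarith
  have e1 : √(N * τ) ≤ 1.01 * q := by
    refine le_trans (Real.sqrt_le_sqrt ?_) hq'
    nlinarith
  have e2 : √(N * τ * L) ≤ 1.01 * q := by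
    refine le_trans (Real.sqrt_le_sqrt ?_) hq'
    nlinarith
  have e3 : √(4 * K * L) * √(J * (N * τ)) ≤ 2.02 * q := by
    rw [← Real.sqrt_mul (by positivity)]
    have : 4 * K * L * (J * (N * τ)) = 2 ^ 2 * (P * (N * τ)) := by
      rw [hP]
      ring
    rw [this, Real.sqrt_mul (by norm_num), Real.sqrt_sq (by norm_num)]
    linarith
  have hcoef : l + (τ - 1) * m ≤ m * τ := by nlinarith
  have h4 : 4 * τ * J + 5 * √(4 * K * L) * √(J * (N * τ)) ≤ 4 * τ * J + 10.1 * q := by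
    linarith
  have h5 : (l + (τ - 1) * m) * (4 * τ * J + 5 * √(4 * K * L) * √(J * (N * τ))) ≤
      m * τ * (4 * τ * J + 10.1 * q) :=
    mul_le_mul hcoef h4 (by positivity) (by linarith)
  have h6 : 15 * (τ * J) ≤ q := by
    have h7 : m * τ * (2 * J) ≤ m * τ * P := by gcongr
    have h8 : τ * J ≤ m * τ * J := by gcongr
    linarith
  have h7 : τ * q ≤ m * τ * q := by gcongr
  have h8 : q ≤ m * τ * q := le_mul_of_one_le_left hq0 hmτ
  have h9 : m * τ * (15 * (τ * J)) ≤ m * τ * q := by gcongr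
  have h10 : τ ^ 2 ≤ m * τ * (τ * J) := by
    have : τ * τ ≤ m * τ * (τ * J) :=
      mul_le_mul hmτ' (le_mul_of_one_le_right (by linarith) hJ) (by linarith) (by linarith)
    linarith
  have h11 : τ * √(N * τ * L) ≤ τ * (1.01 * q) := by gcongr
  -- In units of `m τ q`, the square roots contribute `2.02 + 10.1 + 1.01`, and the terms with `4τJ`
  -- and `2τ²` contribute at most `4/15 + 2/15`; the total is below 15.
  linarith

theorem measure_iUnion_iUnion_le {Ω : Type*} [MeasurableSpace Ω] {Pr : Measure Ω} {p J : ℕ}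
    {κ : Fin p → Type*} [∀ i, Fintype (κ i)] (hκ : ∀ i, Fintype.card (κ i) = J) (hJ : 0 < J)
    {B : ∀ i, κ i → Set Ω} {δ : ℝ} (hδ : 0 < δ) (hδ' : δ < 1)
    (hB : ∀ i z, Pr (B i z) ≤ ENNReal.ofReal (4 / (4 * p * J / δ) ^ 2)) :
    Pr (⋃ i, ⋃ z, B i z) ≤ ENNReal.ofReal (δ / 4) := by
  have h1 : Pr (⋃ i, ⋃ z, B i z) ≤ ∑ _i : Fin p, J * ENNReal.ofReal (4 / (4 * p * J / δ) ^ 2) := by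
    refine (measure_iUnion_fintype_le Pr _).trans (Finset.sum_le_sum fun i _ => ?_)
    refine (measure_iUnion_fintype_le Pr _).trans ?_
    calc _ ≤ ∑ _z : κ i, ENNReal.ofReal (4 / (4 * p * J / δ) ^ 2) :=
          Finset.sum_le_sum fun z _ => hB i z
      _ = _ := by rw [Finset.sum_const, Finset.card_univ, hκ i, nsmul_eq_mul]
  refine h1.trans ?_
  rw [Finset.sum_const, Finset.card_univ, Fintype.card_fin, nsmul_eq_mul, ← mul_assoc,
    ← ENNReal.ofReal_natCast, ← ENNReal.ofReal_natCast, ← ENNReal.ofReal_mul (by positivity),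
    ← ENNReal.ofReal_mul (by positivity)]
  refine ENNReal.ofReal_le_ofReal ?_
  -- There are no reward factors if `m = 1`. For `p > 0` the total `p J · 4 / (4pJ/δ)²` is `δ² /
  -- (4pJ)`.
  rcases Nat.eq_zero_or_pos p with rfl | hp
  · simp only [Nat.cast_zero, zero_mul]
    positivity
  have hpJ : (1 : ℝ) ≤ p * J := by exact_mod_cast Nat.mul_pos hp hJ
  have h2 : (p : ℝ) * J * (4 / (4 * p * J / δ) ^ 2) = δ * δ / (4 * (p * J)) := by
    have hp0 : (p : ℝ) ≠ 0 := by positivity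
    have hJ0 : (J : ℝ) ≠ 0 := by positivity
    field_simp
  rw [h2]
  refine div_le_div₀ hδ.le ?_ (by norm_num) (by linarith)
  exact mul_le_of_le_one_left hδ.le hδ'.le

theorem two_le_log {x : ℝ} (hx : 12 ≤ x) : 2 ≤ Real.log x := by
  rw [Real.le_log_iff_exp_le (by linarith)]
  have h1 := Real.exp_one_lt_d9
  have h2 : Real.exp 2 = Real.exp 1 * Real.exp 1 := by
    rw [← Real.exp_add]
    norm_num
  have h3 := Real.exp_pos 1
  nlinarith

theorem corollary2 {m n l K ζ : ℕ} {S : Fin m → Type uS} {A : Type uA} {X : Fin n → Type uX}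
    [∀ j, Fintype (S j)] [∀ i, Fintype (X i)]
    (G : FactoredGraph S A X l) (hτ : 0 < G.τ) (hG : IsSymmetricGraph G K ζ)
    (M : FactoredMDP G 1 1) (μs : G.Policy) (hμs : M.IsOptimal μs)
    (Γ : Set (FactoredMDP G 1 1) → ℝ → G.Policy) (hΓ : IsOptimisticPlanner Γ)
    (δ : ℝ) (hδ : 0 < δ) (hδ' : δ < 1)
    {Ω : Type uΩ} [MeasurableSpace Ω] (Pr : Measure Ω) [IsProbabilityMeasure Pr]
    (O : Observations G Ω) (hO : IsInteraction Pr M (ucrlFactored Γ δ M.ρ O) O) (T : ℕ) :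
    1 - δ ≤ Pr.real {ω | M.regret μs (fun k => ucrlFactored Γ δ M.ρ O k ω) T ≤
      15 * (m : ℝ) * (G.τ : ℝ) *
        √(((K ^ ζ : ℕ) : ℝ) * (K : ℝ) * (T : ℝ) *
          Real.log (12 * (m : ℝ) * ((K ^ ζ : ℕ) : ℝ) * (T : ℝ) / δ))} := by
  set good : Set Ω := {ω | M.regret μs (fun k => ucrlFactored Γ δ M.ρ O k ω) T ≤
      15 * (m : ℝ) * (G.τ : ℝ) *
        √(((K ^ ζ : ℕ) : ℝ) * (K : ℝ) * (T : ℝ) *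
          Real.log (12 * (m : ℝ) * ((K ^ ζ : ℕ) : ℝ) * (T : ℝ) / δ))} with hgood
  have hall : (∀ ω, ω ∈ good) → 1 - δ ≤ Pr.real good := by
    intro h
    rw [Set.eq_univ_of_forall h, probReal_univ]
    linarith
  rcases Nat.eq_zero_or_pos T with rfl | hT
  · exact hall fun ω => by simp [hgood, FactoredMDP.regret]
  obtain ⟨ω₀⟩ : Nonempty Ω := nonempty_of_isProbabilityMeasure Pr
  -- An observed state at some sample point shows that the factors are non-empty, hence `K > 0`.
  have hS : ∀ j, Nonempty (S j) := fun j => ⟨O.state 0 0 ω₀ j⟩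
  have hm : 0 < m := by have := hG.num; omega
  have hK : 0 < K := by
    have := hS ⟨0, hm⟩
    rw [← hG.card_S ⟨0, hm⟩]
    exact Fintype.card_pos
  have hcard : ∀ Z : Finset (Fin n), Z.card = ζ → Fintype.card (ScopeSet X Z) = K ^ ζ := by
    intro Z hZ
    rw [Fintype.card_pi, ← hZ]
    simp [hG.card_X]
  have hJ : 0 < K ^ ζ := Nat.pow_pos hK
  set J := K ^ ζ with hJdef
  set L := Real.log (12 * (m : ℝ) * (J : ℝ) * (T : ℝ) / δ) with hL
  set N := ⌈(T : ℝ) / (G.τ : ℝ)⌉₊ with hN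
  have hτ1 : (1 : ℝ) ≤ G.τ := by exact_mod_cast hτ
  have hT1 : (1 : ℝ) ≤ T := by exact_mod_cast hT
  have hm1 : (1 : ℝ) ≤ m := by exact_mod_cast hm
  have hJ1 : (1 : ℝ) ≤ J := by exact_mod_cast hJ
  have hK1 : (1 : ℝ) ≤ K := by exact_mod_cast hK
  have hNT : (N : ℝ) * G.τ ≤ T + G.τ := by
    have := (Nat.ceil_lt_add_one (show (0 : ℝ) ≤ (T : ℝ) / G.τ by positivity)).le
    calc (N : ℝ) * G.τ ≤ ((T : ℝ) / G.τ + 1) * G.τ := by gcongr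
      _ = T + G.τ := by field_simp
  have hNT' : N ≤ T := by
    refine Nat.ceil_le.2 (div_le_self (by positivity) hτ1)
  have hN1 : 0 < N := Nat.ceil_pos.2 (by positivity)
  have hmJT : 1 ≤ (m : ℝ) * J * T :=
    one_le_mul_of_one_le_of_one_le (one_le_mul_of_one_le_of_one_le hm1 hJ1) hT1
  have hx : 12 * ((m : ℝ) * J * T) ≤ 12 * (m : ℝ) * J * T / δ := by
    rw [le_div_iff₀ hδ]
    nlinarith
  have hL2 : 2 ≤ L := two_le_log (by linarith)
  have hregret : ∀ ω, M.regret μs (fun k => ucrlFactored Γ δ M.ρ O k ω) T =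
      ∑ k ∈ Finset.range N,
        (M.episodeValue μs - M.episodeValue (ucrlFactored Γ δ M.ρ O k ω)) := fun ω => rfl
  -- An episode costs at most `τ`, so `N τ` always bounds the regret. The other case supplies the
  -- lower bound on `T` used for the constants.
  by_cases hlarge : (N : ℝ) * G.τ ≤ 15 * (m : ℝ) * (G.τ : ℝ) * √((J : ℝ) * K * T * L)
  · refine hall fun ω => ?_
    rw [hgood, Set.mem_ofPred_eq, hregret]
    refine le_trans ?_ hlarge
    calc _ ≤ ∑ _k ∈ Finset.range N, (G.τ : ℝ) := Finset.sum_le_sum fun k _ => by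
          have h1 := (M.episodeValue_mem hτ μs).2
          have h2 := (M.episodeValue_mem hτ (ucrlFactored Γ δ M.ρ O k ω)).1
          linarith
      _ = N * G.τ := by rw [Finset.sum_const, Finset.card_range, nsmul_eq_mul]
  rw [not_le] at hlarge
  have hβ : 0 ≤ 4 * K * L := by positivity
  -- As `k + 1 ≤ N ≤ T`, all the squared radii up to episode `N` are bounded by the single number `4
  -- K L`.
  have hlog : ∀ p : ℕ, 0 < p → p ≤ m → ∀ k < N,
      Real.log (4 * p * (J : ℝ) * ((k : ℝ) + 1) / δ) ≤ L := by
    intro p hp hpm k hk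
    have hp0 : (0 : ℝ) < p := by exact_mod_cast hp
    have hpm' : (p : ℝ) ≤ m := by exact_mod_cast hpm
    have hkT : (k : ℝ) + 1 ≤ T := by exact_mod_cast (Nat.succ_le_of_lt hk).trans hNT'
    refine Real.log_le_log (by positivity) ?_
    gcongr
    norm_num
  have hR : ∀ k < N, ∀ i, dReward G 1 δ k i ≤ 4 * K * L := by
    intro k hk i
    have h1 := hlog l i.pos (by have := hG.num; omega) k hk
    rw [dReward, hcard _ (hG.card_ZR i)]
    simp only [NNReal.coe_one, one_pow, mul_one]
    have h2 : L ≤ K * L := le_mul_of_one_le_left (by linarith) hK1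
    linarith
  have hP : ∀ k < N, ∀ j, dTrans G δ k j ≤ 4 * K * L := by
    intro k hk j
    have h1 := hlog m hm le_rfl k hk
    rw [dTrans, hcard _ (hG.card_ZP j), hG.card_S]
    gcongr
  let BR : ∀ i, ScopeSet X (G.ZR i) → Set Ω := fun i z =>
    {ω | ∃ k, 2 * G.τ ≤ k ∧ k < N ∧ 0 < (O.visits k ω (G.ZR i) z).card ∧
      √(dReward G 1 δ k i / ((O.visits k ω (G.ZR i) z).card : ℝ)) <
        |(∫ r, r ∂(M.R i z)) - O.empReward k ω i z|}
  let BP : ∀ j, ScopeSet X (G.ZP j) → Set Ω := fun j z =>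
    {ω | ∃ k, 2 * G.τ ≤ k ∧ k < N ∧ 0 < (O.visits k ω (G.ZP j) z).card ∧
      √(dTrans G δ k j / ((O.visits k ω (G.ZP j) z).card : ℝ)) <
        ∑ y, |M.P j z y - O.empTrans k ω j z y|}
  let φ : ℕ → Fin (G.τ + 1) → Ω → (∀ j, S j) → ℝ := fun k v ω =>
    M.clippedGap hτ (ucrlFactored Γ δ M.ρ O k ω) (O.stepWidth (factorWidth G.τ (4 * K * L)) k ω)
      (G.τ - v)
  let BM : Set Ω := {ω | (G.τ : ℝ) * √((N : ℝ) * G.τ * L) ≤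
    ∑ k ∈ Finset.range N, ∑ v, M.arrivalDiff O k v (φ k v ω) ω}
  have hcge : ∀ p : ℕ, 0 < p → 4 ≤ 4 * (p : ℝ) * J / δ := by
    intro p hp
    have hp1 : (1 : ℝ) ≤ p := by exact_mod_cast hp
    have := one_le_mul_of_one_le_of_one_le hp1 hJ1
    rw [le_div_iff₀ hδ]
    nlinarith
  have hBR : Pr (⋃ i, ⋃ z, BR i z) ≤ ENNReal.ofReal (δ / 4) := by
    refine measure_iUnion_iUnion_le (fun i => hcard _ (hG.card_ZR i)) hJ hδ hδ' fun i z => ?_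
    refine hO.measure_reward_confidence_le hτ i z ?_ ?_ N
    · rw [hcard _ (hG.card_ZR i)]
    · linarith [hcge l i.pos]
  have hBP : Pr (⋃ j, ⋃ z, BP j z) ≤ ENNReal.ofReal (δ / 4) := by
    refine measure_iUnion_iUnion_le (fun j => hcard _ (hG.card_ZP j)) hJ hδ hδ' fun j z => ?_
    have := hS j
    refine hO.measure_trans_confidence_le hτ j z ?_ ?_ N
    · rw [hcard _ (hG.card_ZP j)]
    · linarith [hcge m hm]
  have hw : ∀ k ω x, 0 ≤ O.stepWidth (factorWidth G.τ (4 * K * L)) k ω x := fun k ω x =>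
    add_nonneg (Finset.sum_nonneg fun i _ => factorWidth_nonneg _ _ _)
      (mul_nonneg (by linarith) (Finset.sum_nonneg fun i _ => factorWidth_nonneg _ _ _))
  have hBM : Pr BM ≤ ENNReal.ofReal (δ / 4) := by
    set y := √((N : ℝ) * G.τ * L) with hy
    have hpos : 0 < (N : ℝ) * G.τ * L := by positivity
    have hy0 : 0 < y := Real.sqrt_pos.2 hpos
    have hy2 : y ^ 2 = N * G.τ * L := Real.sq_sqrt hpos.le
    have h1 := hO.measure_sum_arrivalDiff_ge_le (φ := φ)
      (fun k v s => hO.measurable_clippedGap hτ _ k _ s) (b := G.τ)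
      (fun k v ω s => by
        have h := M.clippedGap_mem zero_le_one hτ (ucrlFactored Γ δ M.ρ O k ω) (hw k ω)
          (G.τ - v) s
        refine ⟨h.1, h.2.trans ?_⟩
        rw [one_mul]
        exact_mod_cast Nat.sub_le _ _) N ((G.τ : ℝ) * y)
      (t := 2 * L / (G.τ * y)) (by positivity)
    refine h1.trans (ENNReal.ofReal_le_ofReal ?_)
    -- With this Chernoff parameter the linear term is `2L` and the quadratic one at most `L`,
    -- because `τ + 1 ≤ 2τ`; this leaves `exp (-L) ≤ δ / 4`.
    have h2 : 2 * L / (G.τ * y) * (G.τ * y) = 2 * L := by field_simp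
    have h3 : (N : ℝ) * (G.τ + 1) * ((2 * L / (G.τ * y)) ^ 2 * (G.τ : ℝ) ^ 2 / 8) ≤ L := by
      have h4 : (2 * L / (G.τ * y)) ^ 2 * (G.τ : ℝ) ^ 2 / 8 = L ^ 2 / (2 * y ^ 2) := by
        field_simp
        norm_num
      rw [h4, hy2, ← mul_div_assoc, div_le_iff₀ (by positivity)]
      have h5 : (N : ℝ) * (G.τ + 1) * L ^ 2 ≤ N * (2 * G.τ) * L ^ 2 := by
        gcongr
        linarith
      linarith
    have h6 : Real.exp (-L) ≤ δ / 4 := by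
      rw [Real.exp_neg, hL, Real.exp_log (by positivity), inv_div]
      exact div_le_div_of_nonneg_left hδ.le (by norm_num) (by linarith)
    exact (Real.exp_le_exp.2 (by linarith)).trans h6
  -- Covering the space by the good and the bad events and using subadditivity avoids any
  -- measurability of `good`.
  have hcover : Set.univ ⊆ good ∪ ((⋃ i, ⋃ z, BR i z) ∪ (⋃ j, ⋃ z, BP j z) ∪ BM) := by
    intro ω _
    by_contra hω
    simp only [Set.mem_union, not_or, Set.mem_iUnion, not_exists] at hω
    obtain ⟨hωg, ⟨hωR, hωP⟩, hωM⟩ := hω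
    refine hωg ?_
    have hM : ∀ k, 2 * G.τ ≤ k → k < N → M ∈ confidenceSet 1 1 δ M.ρ O k ω := by
      refine fun k hk hkN => ⟨rfl, fun i z hz => ?_, fun j z hz => ?_⟩
      · by_contra h
        exact hωR i z ⟨k, hk, hkN, hz, not_le.1 h⟩
      · by_contra h
        exact hωP j z ⟨k, hk, hkN, hz, not_le.1 h⟩
    have h1 := sum_episodeValue_sub_le hO hΓ hτ hM hR hP μs
    have h2 := O.sum_stepWidth_le (fun i => hcard _ (hG.card_ZR i))
      (fun j => hcard _ (hG.card_ZP j)) hτ hβ N ω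
    have h3 : ∑ k ∈ Finset.range N, ∑ v, M.arrivalDiff O k v (φ k v ω) ω <
      (G.τ : ℝ) * √((N : ℝ) * G.τ * L) := not_le.1 hωM
    have h4 := regret_bound_le hτ1 (l := l) (by exact_mod_cast hG.num) hm1 hJ1 hK1 hL2 hT1
      (Nat.cast_nonneg N) hNT hlarge
    rw [hgood, Set.mem_ofPred_eq, hregret]
    linarith
  have hbad : Pr.real ((⋃ i, ⋃ z, BR i z) ∪ (⋃ j, ⋃ z, BP j z) ∪ BM) ≤ δ := by
    refine ENNReal.toReal_le_of_le_ofReal hδ.le ?_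
    calc _ ≤ ENNReal.ofReal (δ / 4) + ENNReal.ofReal (δ / 4) + ENNReal.ofReal (δ / 4) :=
          (measure_union_le _ _).trans (add_le_add ((measure_union_le _ _).trans
            (add_le_add hBR hBP)) hBM)
      _ ≤ ENNReal.ofReal δ := by
          rw [← ENNReal.ofReal_add (by positivity) (by positivity),
            ← ENNReal.ofReal_add (by positivity) (by positivity)]
          exact ENNReal.ofReal_le_ofReal (by linarith)
  have h1 := (measureReal_mono hcover (by finiteness)).trans (measureReal_union_le (μ := Pr) _ _)
  rw [probReal_univ] at h1
  linarith
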